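/- Let $p$ be an odd prime and let $n,k\ge 1$ be integers. **The Hopf algebras.** Let $S(n)=\mathbb Z/p\otimes_{K(n)_*}K(n)_*K(n)\otimes_{K(n)_*}\mathbb Z/p=\mathbb Z/p[t_1,t_2,\dots]/(t_s^{p^n}-t_s)$ be the Morava stabilizer algebra ($v_n\mapsto 1$), with the coproduct induced from $BP_*BP$ (Hazewinkel generators), and let $S(n,k)=S(n)/(t_j: j<k)=\mathbb Z/p[t_k,t_{k+1},\dots]/(t_s^{p^n}-t_s)$, with inner degree $|t_s|=2(p^s-1)$ modulo $2(p^n-1)$. Let $T(n,k)=\mathbb Z/p[\xi_i\mid k\le i\le n+k-1]$, with $|\xi_i|=2(p^i-1)$ and $\Delta\xi_i=\xi_i\otimes1+\sum_{k\le r\le i-k}\xi_r\otimes\xi_{i-r}^{p^r}+1\otimes\xi_i$. Let $\Phi:T(n,k)\to S(n,k)$ be the map of Hopf algebras with $\Phi(\xi_i)=t_i$. **The May filtrations.** On $S(n,k)$ put $M(t_s^{p^j})=2s-1$ for $k\le s\le n+k-1$ and, inductively, $M(t_s^{p^j})=\max\{2s-1,\;pM(t_{s-n}^{p^{j+n-1}})+1\}$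 for $s\ge n+k$; on $T(n,k)$ put $M(\xi_i^{p^j})=2i-1$. Extend $M$ to the monomials of the monomial bases (exponents $<p^n$ in the case of $S(n,k)$) additively over the $p$-adic digits of the exponents and over the different variables. Let $F^{t,M}$ be the span of the basis monomials of inner degree $t$ and May filtration $\le M$. On the cobar complexes $C^{s,t}$, where $C^s=\bar A^{\otimes s}$ with $\bar A=\ker\varepsilon$ and $d[\alpha_1|\dots|\alpha_s]=\sum_i(-1)^i[\alpha_1|\dots|\Delta\alpha_i-\alpha_i\otimes1-1\otimes\alpha_i|\dots|\alpha_s]$, put $M([\alpha_1|\dots|\alpha_s])=\sum_i M(\alpha_i)$ and let $F^MC^{s,t}$ be the span of the $[\alpha_1|\dots|\alpha_s]$ of inner degree $t$, with basis monomials $\alpha_i$, of May filtration $\le M$. The May spectral sequence is the spectral sequence of this increasing filtration: $E_r^{s,t,M}=Z_r^{s,t,M}/(Z_{r-1}^{s,t,M-1}+dZ_{r-1}^{s-1,t,M+r-1})$ with $Z_r^{s,t,M}=\{z\in F^MC^{s,t}: dz\in F^{M-r}C^{s+1,t}\}$, and $d_r:E_r^{s,t,M}\to E_r^{s+1,t,M-r}$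 is induced by $d$. **Theorem.** The map $\Phi$ preserves the May filtration: $\Phi(F^{t,M}T(n,k))\subseteq F^{t,M}S(n,k)$, and the induced map of cobar complexes is a filtration preserving cochain map. It induces homomorphisms $\Phi:E_r^{s,t,M}T(n,k)\to E_r^{s,t,M}S(n,k)$ (the class of $z$ goes to the class of $\Phi(z)$) which form a homomorphism of May spectral sequences: they commute with every $d_r$, they are compatible with the passage from $E_r$ to $E_{r+1}$, and they are multiplicative. For $k\le i\le n+k-1$ and $j\ge0$, $$\Phi(h'_{i,j})=h_{i,j},\qquad \Phi(b'_{i,j})=b_{i,j}\quad\text{in } E_1,$$ where the second index of $h_{i,j}$ and $b_{i,j}$ is read modulo $n$, the classes $h'_{i,j}\in E_1^{1,2(p^i-1)p^j,2i-1}T(n,k)$ and $b'_{i,j}\in E_1^{2,2(p^i-1)p^{j+1},p(2i-1)}T(n,k)$ are represented by $[\xi_i^{p^j}]$ and $\sum_{0<m<p}\frac1p\binom pm[\xi_i^{mp^j}|\xi_i^{(p-m)p^j}]$, and $h_{i,j},b_{i,j}$ are represented by the same expressions in $t_i$. Finally, $\Phi$ sends infinite (permanent) cycles of $E_r^{*,*,*}T(n,k)$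 to infinite cycles of $E_r^{*,*,*}S(n,k)$, for every $r$. -/

import Mathlib

namespace MaySS

open Finset
open scoped TensorProduct

/-! ### The coproduct of the Morava stabilizer algebra

Specialise `BP_* BP = BP_*[t_1, t_2, ...]` along `BP_* → ℤ_(p)`, `v_n ↦ 1`, `v_i ↦ 0` for `i ≠ n`
(Hazewinkel generators).  The logarithm coefficients `m_i`, given by `m_0 = 1` and
`p m_s = ∑_{0 ≤ i < s} v_{s-i}^{p^i} m_i`, become `m_{an} = p^{-a}` and `m_i = 0` for `n ∤ i`, and the
coproduct, given by `∑_{i+j=s} m_i Δ(t_j)^{p^i} = ∑_{i+j+l=s} m_i t_j^{p^i} ⊗ t_l^{p^{i+j}}` with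
`t_0 = 1`, becomes a sequence of integral polynomials.  Reducing modulo `p` and
`t_s^{p^n} = t_s` gives the coproduct of `S(n)`. -/

/-- The coefficients `m_i` of the logarithm, for `v_n = 1` and `v_i = 0` (`i ≠ n`). -/
def logCoeff (p n i : ℕ) : ℚ := if n ∣ i then ((p : ℚ)⁻¹) ^ (i / n) else 0

theorem sum_antidiagonal_dvd {M : Type*} [AddCommMonoid M] (n : ℕ) [NeZero n] (s : ℕ)
    (f : ℕ → ℕ → M) :
    ∑ x ∈ antidiagonal s, (if n ∣ x.1 then f x.1 x.2 else 0) =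
      ∑ a ∈ range (s / n + 1), f (a * n) (s - a * n) := by
  have hn : 0 < n := Nat.pos_of_ne_zero (NeZero.ne n)
  rw [Finset.Nat.sum_antidiagonal_eq_sum_range_succ (fun i j => if n ∣ i then f i j else 0)]
  symm
  refine Finset.sum_of_injOn (fun a => a * n) ?_ ?_ ?_ ?_
  · intro a _ b _ h
    exact Nat.eq_of_mul_eq_mul_right hn h
  · intro a ha
    simp only [coe_range, Set.mem_Iio] at ha ⊢
    have := (Nat.le_div_iff_mul_le hn).1 (Nat.lt_succ_iff.1 ha)
    omega
  · intro i hi hni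
    rw [if_neg]
    rintro ⟨c, rfl⟩
    apply hni
    refine ⟨c, ?_, by simp [mul_comm]⟩
    simp only [coe_range, Set.mem_Iio, mem_range] at hi ⊢
    have := (Nat.le_div_iff_mul_le hn).2 (by rw [mul_comm]; omega : c * n ≤ s)
    omega
  · intro a _
    simp

theorem sum_logCoeff (p n : ℕ) [hp : Fact p.Prime] [NeZero n] {σ : Type} (s : ℕ)
    (f : ℕ → ℕ → MvPolynomial σ ℤ) :
    (MvPolynomial.C ((p : ℚ) ^ (s / n))) * ∑ x ∈ antidiagonal s,
      MvPolynomial.C (logCoeff p n x.1) * MvPolynomial.map (Int.castRingHom ℚ) (f x.1 x.2) =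
    MvPolynomial.map (Int.castRingHom ℚ)
      (∑ a ∈ range (s / n + 1), (p : MvPolynomial σ ℤ) ^ (s / n - a) * f (a * n) (s - a * n)) := by
  have hn : 0 < n := Nat.pos_of_ne_zero (NeZero.ne n)
  have hp0 : (p : ℚ) ≠ 0 := by exact_mod_cast hp.out.ne_zero
  have h1 : ∀ i j, MvPolynomial.C (logCoeff p n i) * MvPolynomial.map (Int.castRingHom ℚ) (f i j) =
      if n ∣ i then MvPolynomial.C (((p : ℚ)⁻¹) ^ (i / n)) *
        MvPolynomial.map (Int.castRingHom ℚ) (f i j) else 0 := by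
    intro i j
    by_cases h : n ∣ i <;> simp [logCoeff, h]
  rw [Finset.sum_congr rfl fun x _ => h1 x.1 x.2,
    sum_antidiagonal_dvd n s (fun i j => MvPolynomial.C (((p : ℚ)⁻¹) ^ (i / n)) *
        MvPolynomial.map (Int.castRingHom ℚ) (f i j)), Finset.mul_sum, map_sum]
  refine Finset.sum_congr rfl fun a ha => ?_
  have ha' : a ≤ s / n := by simpa [Nat.lt_succ_iff] using ha
  rw [← mul_assoc, ← map_mul, Nat.mul_div_cancel _ hn]
  have h2 : (p : ℚ) ^ (s / n) * ((p : ℚ)⁻¹) ^ a = (p : ℚ) ^ (s / n - a) := by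
    rw [inv_pow, ← div_eq_mul_inv, pow_sub₀ _ hp0 ha', div_eq_mul_inv]
  rw [h2]
  simp

theorem natCast_dvd_expand_sub_pow (p n : ℕ) [hp : Fact p.Prime] {σ : Type}
    (e : MvPolynomial σ ℤ) :
    (p : MvPolynomial σ ℤ) ∣ MvPolynomial.expand (p ^ n) e - e ^ p ^ n := by
  rw [← MvPolynomial.C_eq_coe_nat, show ((p : ℕ) : ℤ) = (p : ℤ) from rfl,
    MvPolynomial.C_dvd_iff_zmod]
  have h : ∀ (m : ℕ) (f : MvPolynomial σ (ZMod p)), MvPolynomial.expand (p ^ m) f = f ^ p ^ m := by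
    intro m
    induction m with
    | zero => intro f; simp
    | succ m ih =>
      intro f
      rw [pow_succ, MvPolynomial.expand_mul, MvPolynomial.expand_zmod, map_pow, ih, ← pow_mul]
  rw [map_sub, MvPolynomial.map_expand, h, map_pow, sub_self]

theorem exists_integral_comul (p n : ℕ) [hp : Fact p.Prime] [NeZero n] {σ : Type}
    (c : ℕ → MvPolynomial σ ℤ) :
    ∃ D : ℕ → MvPolynomial σ ℤ, ∀ s,
      ∑ a ∈ range (s / n + 1), (p : MvPolynomial σ ℤ) ^ (s / n - a) *
        D (s - a * n) ^ p ^ (a * n) =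
      ∑ a ∈ range (s / n + 1), (p : MvPolynomial σ ℤ) ^ (s / n - a) *
        MvPolynomial.expand (p ^ (a * n)) (c (s - a * n)) := by
  have hn : 0 < n := Nat.pos_of_ne_zero (NeZero.ne n)
  have key : ∀ (a : ℕ) (e : MvPolynomial σ ℤ), ∃ g : MvPolynomial σ ℤ,
      MvPolynomial.expand (p ^ n) e ^ p ^ (a * n) - (e ^ p ^ n) ^ p ^ (a * n) =
        (p : MvPolynomial σ ℤ) ^ (a + 1) * g := by
    intro a e
    have h := dvd_sub_pow_of_dvd_sub (natCast_dvd_expand_sub_pow p n e) (a * n)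
    have h2 : (p : MvPolynomial σ ℤ) ^ (a + 1) ∣ (p : MvPolynomial σ ℤ) ^ (a * n + 1) :=
      pow_dvd_pow _ (by nlinarith)
    obtain ⟨g, hg⟩ := h2.trans h
    exact ⟨g, hg⟩
  choose g hg using key
  let D : ℕ → MvPolynomial σ ℤ := fun s => Nat.strongRec (motive := fun _ => MvPolynomial σ ℤ)
    (fun s ih => c s + ∑ a ∈ (range (s / n)).attach, if h : s - (a.1 + 1) * n < s then
      g a.1 (ih (s - (a.1 + 1) * n) h) else 0) s
  have hD : ∀ s, D s = c s + ∑ a ∈ range (s / n), g a (D (s - (a + 1) * n)) := by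
    intro s
    have : D s = c s + ∑ a ∈ (range (s / n)).attach, if h : s - (a.1 + 1) * n < s then
      g a.1 (D (s - (a.1 + 1) * n)) else 0 := by
      simp only [D]
      rw [Nat.strongRec]
    rw [this, ← Finset.sum_attach (range (s / n))]
    congr 1
    refine Finset.sum_congr rfl fun a _ => ?_
    have ha : a.1 < s / n := Finset.mem_range.1 a.2
    have hs : 0 < s := by
      rcases Nat.eq_zero_or_pos s with h | h
      · subst h; simp at ha
      · exact h
    have : 0 < (a.1 + 1) * n := by positivity
    rw [dif_pos (by omega)]
  refine ⟨D, fun s => ?_⟩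
  induction s using Nat.strong_induction_on with
  | _ s ih =>
    rw [Finset.sum_range_succ', Finset.sum_range_succ']
    simp only [zero_mul, Nat.sub_zero, pow_zero, pow_one, MvPolynomial.expand_one]
    rcases Nat.lt_or_ge s n with hs | hs
    · have : s / n = 0 := Nat.div_eq_of_lt hs
      simp [this, hD s]
    · have hq : s / n = (s - n) / n + 1 := Nat.div_eq_sub_div hn hs
      have ih' := congrArg (MvPolynomial.expand (p ^ n)) (ih (s - n) (by omega))
      simp only [map_sum, map_mul, map_pow, map_natCast, ← MvPolynomial.expand_mul] at ih'
      conv_lhs => rw [hD s]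
      rw [hq]
      have e1 : ∀ a ∈ range ((s - n) / n + 1), (p : MvPolynomial σ ℤ) ^ ((s - n) / n + 1 - (a + 1)) *
          MvPolynomial.expand (p ^ ((a + 1) * n)) (c (s - (a + 1) * n)) =
          (p : MvPolynomial σ ℤ) ^ ((s - n) / n - a) *
          MvPolynomial.expand (p ^ n * p ^ (a * n)) (c (s - n - a * n)) := by
        intro a _
        rw [show s - (a + 1) * n = s - n - a * n by rw [add_mul, one_mul]; omega,
          show p ^ ((a + 1) * n) = p ^ n * p ^ (a * n) by rw [← pow_add]; congr 1; ring]
        simp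
      rw [Finset.sum_congr rfl e1, ← ih', mul_add, Finset.mul_sum, add_comm (_ * c s), ← add_assoc,
        ← Finset.sum_add_distrib]
      congr 1
      refine Finset.sum_congr rfl fun a ha => ?_
      have ha' : a ≤ (s - n) / n := by simpa [Nat.lt_succ_iff] using ha
      rw [show s - (a + 1) * n = s - n - a * n by rw [add_mul, one_mul]; omega]
      rw [show (s - n) / n + 1 = ((s - n) / n - a) + (a + 1) by omega, pow_add _ _ (a + 1), mul_assoc,
        ← hg]
      rw [show p ^ ((a + 1) * n) = p ^ n * p ^ (a * n) by rw [← pow_add]; congr 1; ring, pow_mul]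
      rw [Nat.add_sub_cancel]
      ring

open MvPolynomial in
theorem exists_comulPoly (p n : ℕ) [hp : Fact p.Prime] [NeZero n] :
    ∃ D : ℕ → MvPolynomial (ℕ ⊕ ℕ) ℤ, ∀ s,
      ∑ x ∈ antidiagonal s,
        C (logCoeff p n x.1) * map (Int.castRingHom ℚ) (D x.2) ^ p ^ x.1 =
      ∑ x ∈ antidiagonal s, ∑ y ∈ antidiagonal x.2, C (logCoeff p n x.1) *
        (X (Sum.inl y.1) ^ p ^ x.1 * X (Sum.inr y.2) ^ p ^ (x.1 + y.1)) := by
  obtain ⟨D, hD⟩ := exists_integral_comul p n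
    (fun s => ∑ y ∈ antidiagonal s, X (Sum.inl y.1 : ℕ ⊕ ℕ) * X (Sum.inr y.2) ^ p ^ y.1)
  refine ⟨D, fun s => ?_⟩
  have hp0 : (C ((p : ℚ) ^ (s / n)) : MvPolynomial (ℕ ⊕ ℕ) ℚ) ≠ 0 := by
    rw [Ne, MvPolynomial.C_eq_zero]
    exact pow_ne_zero _ (by exact_mod_cast hp.out.ne_zero)
  apply mul_left_cancel₀ hp0
  have h1 := sum_logCoeff p n s (fun i j => D j ^ p ^ i)
  have h2 := sum_logCoeff p n s (fun i j => ∑ y ∈ antidiagonal j,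
    X (Sum.inl y.1 : ℕ ⊕ ℕ) ^ p ^ i * X (Sum.inr y.2) ^ p ^ (i + y.1))
  simp only [map_pow (MvPolynomial.map _)] at h1
  rw [h1, hD s]
  simp only [map_sum (MvPolynomial.map _), map_mul (MvPolynomial.map _), map_pow (MvPolynomial.map _),
    MvPolynomial.map_X, Finset.mul_sum (antidiagonal _)] at h2
  simp only [Finset.mul_sum]
  rw [h2]
  simp only [map_sum, map_mul, map_pow, MvPolynomial.expand_X, MvPolynomial.map_X, Finset.mul_sum,
    map_natCast, ← pow_mul, ← pow_add]

/-- The coproduct polynomials `Δ_s ∈ ℤ[t_0, t_1, ...; t'_0, t'_1, ...]`, the unique solution of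
`∑_{i+j=s} m_i Δ_j^{p^i} = ∑_{i+j+l=s} m_i t_j^{p^i} t'_l^{p^{i+j}}`.  The variable `t_j` is
`X (Sum.inl j)` and stands for `t_j ⊗ 1`; the variable `t'_l` is `X (Sum.inr l)` and stands for
`1 ⊗ t_l`. -/
noncomputable def comulPoly (p n : ℕ) [Fact p.Prime] [NeZero n] : ℕ → MvPolynomial (ℕ ⊕ ℕ) ℤ :=
  Classical.choose (exists_comulPoly p n)

open MvPolynomial in
theorem comulPoly_ghost (p n : ℕ) [hp : Fact p.Prime] [NeZero n] (s : ℕ) :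
    ∑ a ∈ range (s / n + 1), (p : MvPolynomial (ℕ ⊕ ℕ) ℤ) ^ (s / n - a) *
        comulPoly p n (s - a * n) ^ p ^ (a * n) =
      ∑ a ∈ range (s / n + 1), (p : MvPolynomial (ℕ ⊕ ℕ) ℤ) ^ (s / n - a) *
        ∑ y ∈ antidiagonal (s - a * n),
          X (Sum.inl y.1) ^ p ^ (a * n) * X (Sum.inr y.2) ^ p ^ (a * n + y.1) := by
  apply MvPolynomial.map_injective (Int.castRingHom ℚ) (RingHom.injective_int _)
  have h1 := sum_logCoeff p n s (fun i j => comulPoly p n j ^ p ^ i)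
  have h2 := sum_logCoeff p n s (fun i j => ∑ y ∈ antidiagonal j,
    X (Sum.inl y.1 : ℕ ⊕ ℕ) ^ p ^ i * X (Sum.inr y.2) ^ p ^ (i + y.1))
  rw [← h1, ← h2]
  congr 1
  have := Classical.choose_spec (exists_comulPoly p n) s
  simp only [map_pow (MvPolynomial.map _), map_sum (MvPolynomial.map _), map_mul (MvPolynomial.map _),
    MvPolynomial.map_X, Finset.mul_sum (antidiagonal _)]
  exact this

set_option linter.unusedSectionVars false

section Ghost

variable {W : Type*} [CommRing W] (p n : ℕ) [NeZero n]

/-- Auxiliary: `p ^ (s / n) * ∑_a p^{-a} u_{s - an}`. -/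
def ghost (u : ℕ → W) (s : ℕ) : W :=
  ∑ a ∈ range (s / n + 1), (p : W) ^ (s / n - a) * u (s - a * n)

theorem ghost_eq (u : ℕ → W) (s : ℕ) : ghost p n u s =
    ∑ x ∈ antidiagonal s, (if n ∣ x.1 then (p : W) ^ (s / n - x.1 / n) * u x.2 else 0) := by
  have hn : 0 < n := Nat.pos_of_ne_zero (NeZero.ne n)
  rw [sum_antidiagonal_dvd n s (fun i j => (p : W) ^ (s / n - i / n) * u j)]
  simp only [ghost, Nat.mul_div_cancel _ hn]

theorem ghost_sub (u v : ℕ → W) (s : ℕ) :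
    ghost p n (u - v) s = ghost p n u s - ghost p n v s := by
  simp [ghost, mul_sub, Finset.sum_sub_distrib]

/-- Auxiliary: the product of twisted power series. -/
def tconv (φ : ℕ → W →+* W) (u v : ℕ → W) (s : ℕ) : W :=
  ∑ x ∈ antidiagonal s, u x.1 * φ x.1 (v x.2)

theorem tconv_sub_left (φ : ℕ → W →+* W) (u u' v : ℕ → W) :
    tconv φ (u - u') v = tconv φ u v - tconv φ u' v := by
  ext s; simp [tconv, sub_mul, Finset.sum_sub_distrib]

theorem tconv_sub_right (φ : ℕ → W →+* W) (u v v' : ℕ → W) :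
    tconv φ u (v - v') = tconv φ u v - tconv φ u v' := by
  ext s; simp [tconv, mul_sub, Finset.sum_sub_distrib]

theorem tconv_assoc (φ : ℕ → W →+* W) (hφ : ∀ i j x, φ (i + j) x = φ i (φ j x)) (u v w : ℕ → W) :
    tconv φ (tconv φ u v) w = tconv φ u (tconv φ v w) := by
  ext s
  simp only [tconv, Finset.sum_mul, Finset.mul_sum, map_sum, map_mul]
  rw [Finset.sum_sigma', Finset.sum_sigma']
  refine Finset.sum_nbij' (fun x => ⟨(x.2.1, x.2.2 + x.1.2), (x.2.2, x.1.2)⟩)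
    (fun x => ⟨(x.1.1 + x.2.1, x.2.2), (x.1.1, x.2.1)⟩) ?_ ?_ ?_ ?_ ?_
  · rintro ⟨⟨a, b⟩, ⟨c, d⟩⟩ h; simp at h ⊢; omega
  · rintro ⟨⟨a, b⟩, ⟨c, d⟩⟩ h; simp at h ⊢; omega
  · rintro ⟨⟨a, b⟩, ⟨c, d⟩⟩ h; simp at h ⊢; obtain ⟨h, rfl⟩ := h; simp
  · rintro ⟨⟨a, b⟩, ⟨c, d⟩⟩ h; simp at h ⊢; obtain ⟨h, rfl⟩ := h; simp
  · rintro ⟨⟨a, b⟩, ⟨c, d⟩⟩ h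
    simp at h ⊢; obtain ⟨h, rfl⟩ := h
    rw [hφ, mul_assoc]

/-- `ghost u ≡ 0` to the relevant precision below `N`. -/
def GhostNull (N : ℕ) (u : ℕ → W) : Prop := ∀ s < N, (p : W) ^ (s / n + 1) ∣ ghost p n u s

variable {p n} in
theorem GhostNull.tconv_right {N : ℕ} {u : ℕ → W} (hu : GhostNull p n N u) (φ : ℕ → W →+* W)
    (hφ : ∀ i j x, φ (i + j) x = φ i (φ j x)) (hφn : ∀ x, φ n x = x) (hφ0 : ∀ x, φ 0 x = x)
    (v : ℕ → W) : GhostNull p n N (tconv φ u v) := by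
  intro s hs
  have hφm : ∀ c x, φ (n * c) x = x := by
    intro c
    induction c with
    | zero => simpa using hφ0
    | succ c ih => intro x; rw [mul_add, mul_one, hφ, hφn, ih]
  have : ghost p n (tconv φ u v) s = ∑ x ∈ antidiagonal s,
      (p : W) ^ (s / n - x.1 / n) * ghost p n u x.1 * φ x.1 (v x.2) := by
    simp only [ghost_eq, tconv, Finset.sum_mul, Finset.mul_sum, ite_mul, mul_ite, mul_zero, zero_mul]
    have : ∀ (x : ℕ × ℕ), (if n ∣ x.1 then ∑ i ∈ antidiagonal x.2,
        (p : W) ^ (s / n - x.1 / n) * (u i.1 * φ i.1 (v i.2)) else 0) =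
        ∑ i ∈ antidiagonal x.2, if n ∣ x.1 then
          (p : W) ^ (s / n - x.1 / n) * (u i.1 * φ i.1 (v i.2)) else 0 := by
      intro x; split_ifs <;> simp
    rw [Finset.sum_congr rfl fun x _ => this x]
    symm
    rw [Finset.sum_sigma', Finset.sum_sigma']
    refine Finset.sum_nbij' (fun x => ⟨(x.2.1, x.2.2 + x.1.2), (x.2.2, x.1.2)⟩)
      (fun x => ⟨(x.1.1 + x.2.1, x.2.2), (x.1.1, x.2.1)⟩) ?_ ?_ ?_ ?_ ?_
    · rintro ⟨⟨a, b⟩, ⟨c, d⟩⟩ h; simp at h ⊢; omega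
    · rintro ⟨⟨a, b⟩, ⟨c, d⟩⟩ h; simp at h ⊢; omega
    · rintro ⟨⟨a, b⟩, ⟨c, d⟩⟩ h; simp at h ⊢; obtain ⟨h, rfl⟩ := h; simp
    · rintro ⟨⟨a, b⟩, ⟨c, d⟩⟩ h; simp at h ⊢; obtain ⟨h, rfl⟩ := h; simp
    · rintro ⟨⟨a, b⟩, ⟨c, d⟩⟩ h
      simp only [mem_sigma, HasAntidiagonal.mem_antidiagonal] at h
      obtain ⟨h, rfl⟩ := h
      simp only
      split_ifs with hc
      · obtain ⟨c', rfl⟩ := hc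
        rw [hφ, hφm]
        have h1 : n * c' / n ≤ (n * c' + d) / n := Nat.div_le_div_right (by omega)
        have h2 : (n * c' + d) / n ≤ s / n := Nat.div_le_div_right (by omega)
        rw [show s / n - n * c' / n = (s / n - (n * c' + d) / n) + ((n * c' + d) / n - n * c' / n)
          by omega, pow_add]
        ring
      · rfl
  rw [this]
  refine Finset.dvd_sum fun x hx => ?_
  have hx' : x.1 + x.2 = s := by simpa using hx
  have h2 : x.1 / n ≤ s / n := Nat.div_le_div_right (by omega)
  refine Dvd.dvd.mul_right ?_ _
  rw [show s / n + 1 = (s / n - x.1 / n) + (x.1 / n + 1) by omega, pow_add]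
  exact mul_dvd_mul_left _ (hu _ (by omega))

variable {p n} in
theorem GhostNull.tconv_left {N : ℕ} {v : ℕ → W} (hv : GhostNull p n N v) (φ : ℕ → W →+* W)
    (u : ℕ → W) : GhostNull p n N (tconv φ u v) := by
  intro s hs
  have : ghost p n (tconv φ u v) s = ∑ x ∈ antidiagonal s,
      (p : W) ^ (s / n - x.2 / n) * (u x.1 * φ x.1 (ghost p n v x.2)) := by
    simp only [ghost_eq, tconv, map_sum, Finset.mul_sum, mul_ite, mul_zero,
      apply_ite (φ _), map_zero]
    have : ∀ (x : ℕ × ℕ), (if n ∣ x.1 then ∑ i ∈ antidiagonal x.2,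
        (p : W) ^ (s / n - x.1 / n) * (u i.1 * φ i.1 (v i.2)) else 0) =
        ∑ i ∈ antidiagonal x.2, if n ∣ x.1 then
          (p : W) ^ (s / n - x.1 / n) * (u i.1 * φ i.1 (v i.2)) else 0 := by
      intro x; split_ifs <;> simp
    rw [Finset.sum_congr rfl fun x _ => this x]
    symm
    rw [Finset.sum_sigma', Finset.sum_sigma']
    refine Finset.sum_nbij' (fun x => ⟨(x.2.1, x.1.1 + x.2.2), (x.1.1, x.2.2)⟩)
      (fun x => ⟨(x.2.1, x.1.1 + x.2.2), (x.1.1, x.2.2)⟩) ?_ ?_ ?_ ?_ ?_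
    · rintro ⟨⟨a, b⟩, ⟨c, d⟩⟩ h; simp at h ⊢; omega
    · rintro ⟨⟨a, b⟩, ⟨c, d⟩⟩ h; simp at h ⊢; omega
    · rintro ⟨⟨a, b⟩, ⟨c, d⟩⟩ h; simp at h ⊢; obtain ⟨h, rfl⟩ := h; simp
    · rintro ⟨⟨a, b⟩, ⟨c, d⟩⟩ h; simp at h ⊢; obtain ⟨h, rfl⟩ := h; simp
    · rintro ⟨⟨a, b⟩, ⟨c, d⟩⟩ h
      simp only [mem_sigma, HasAntidiagonal.mem_antidiagonal] at h
      obtain ⟨h, rfl⟩ := h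
      simp only
      split_ifs with hc
      · obtain ⟨c', rfl⟩ := hc
        have h1 : n * c' / n ≤ (n * c' + d) / n := Nat.div_le_div_right (by omega)
        have h2 : (n * c' + d) / n ≤ s / n := Nat.div_le_div_right (by omega)
        rw [show s / n - n * c' / n = (s / n - (n * c' + d) / n) + ((n * c' + d) / n - n * c' / n)
          by omega, pow_add]
        simp only [map_mul, map_pow, map_natCast]
        ring
      · rfl
  rw [this]
  refine Finset.dvd_sum fun x hx => ?_
  have hx' : x.1 + x.2 = s := by simpa using hx
  have h2 : x.2 / n ≤ s / n := Nat.div_le_div_right (by omega)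
  rw [show s / n + 1 = (s / n - x.2 / n) + (x.2 / n + 1) by omega, pow_add]
  refine mul_dvd_mul_left _ (Dvd.dvd.mul_left ?_ _)
  simpa using map_dvd (φ x.1) (hv x.2 (by omega))

variable {p n} in
theorem GhostNull.add {N : ℕ} {u v : ℕ → W} (hu : GhostNull p n N u) (hv : GhostNull p n N v) :
    GhostNull p n N (u + v) := by
  intro s hs
  have : ghost p n (u + v) s = ghost p n u s + ghost p n v s := by
    simp [ghost, mul_add, Finset.sum_add_distrib]
  rw [this]
  exact dvd_add (hu s hs) (hv s hs)

variable {p n} in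
theorem GhostNull.neg {N : ℕ} {u : ℕ → W} (hu : GhostNull p n N u) : GhostNull p n N (-u) := by
  intro s hs
  have : ghost p n (-u) s = - ghost p n u s := by
    simp [ghost]
  rw [this]
  exact (hu s hs).neg_right

end Ghost

section Star

variable (p n : ℕ) [hp : Fact p.Prime] [NeZero n] {R : Type*} [CommRing R]

/-- The sequence `(Δ_s(x, y))_s` for sequences `x`, `y` in a commutative ring. -/
noncomputable def coordMul (x y : ℕ → R) (s : ℕ) : R :=
  MvPolynomial.eval₂ (Int.castRingHom R) (Sum.elim x y) (comulPoly p n s)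

theorem map_coordMul {S : Type*} [CommRing S] (f : R →+* S) (x y : ℕ → R) (s : ℕ) :
    f (coordMul p n x y s) = coordMul p n (fun j => f (x j)) (fun j => f (y j)) s := by
  rw [coordMul, coordMul, MvPolynomial.hom_eval₂]
  congr 1
  · exact RingHom.ext_int _ _
  · funext i; cases i <;> rfl

variable [CharP R p]

/-- Frobenius powers on Witt vectors -/
noncomputable def frob (i : ℕ) : WittVector p R →+* WittVector p R :=
  WittVector.map (iterateFrobenius R p i)

theorem frob_add (i j : ℕ) (x : WittVector p R) :
    frob p (i + j) x = frob p i (frob p j x) := by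
  ext m; simp [frob, iterateFrobenius_add_apply]

theorem frob_zero (x : WittVector p R) : frob p 0 x = x := by
  ext m; simp [frob]

variable {n} in
theorem frob_n (hR : ∀ x : R, x ^ p ^ n = x) (x : WittVector p R) : frob p n x = x := by
  ext m; simp [frob, iterateFrobenius_def, hR]

theorem frob_teichmuller (i : ℕ) (x : R) : frob p i (WittVector.teichmuller p x) = WittVector.teichmuller p x ^ p ^ i := by
  rw [frob, WittVector.map_teichmuller, iterateFrobenius_def, map_pow]

variable {n} in
theorem perfectRing_of_pow (hR : ∀ x : R, x ^ p ^ n = x) : PerfectRing R p := by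
  have hn : 0 < n := Nat.pos_of_ne_zero (NeZero.ne n)
  obtain ⟨m, rfl⟩ : ∃ m, n = m + 1 := ⟨n - 1, by omega⟩
  refine ⟨⟨fun x y h => ?_, fun x => ⟨x ^ p ^ m, ?_⟩⟩⟩
  · simp only at h
    rw [← hR x, ← hR y, pow_succ', pow_mul, pow_mul, h]
  · simp only
    rw [← pow_mul, ← pow_succ, hR]

variable {n}

theorem dvd_of_coeff_zero (hR : ∀ x : R, x ^ p ^ n = x) {x y : WittVector p R}
    (h : x.coeff 0 = y.coeff 0) : (p : WittVector p R) ∣ x - y := by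
  have := perfectRing_of_pow p hR
  rw [← Ideal.mem_span_singleton, WittVector.mem_span_p_iff_coeff_zero_eq_zero]
  have := (WittVector.le_coeff_eq_iff_le_sub_coeff_eq_zero (x := x) (y := y) (n := 1)).1
    (by intro i hi; obtain rfl : i = 0 := by omega
        exact h)
  exact this 0 one_pos

theorem coeff_zero_of_dvd {x y : WittVector p R}
    (h : (p : WittVector p R) ∣ x - y) : x.coeff 0 = y.coeff 0 := by
  obtain ⟨c, hc⟩ := h
  have h0 : (x - y).coeff 0 = 0 := by rw [hc, mul_comm, WittVector.mul_charP_coeff_zero]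
  have := (WittVector.le_coeff_eq_iff_le_sub_coeff_eq_zero (x := x) (y := y) (n := 1)).2
    (by intro i hi; obtain rfl : i = 0 := by omega
        exact h0)
  exact this 0 one_pos

/-- Uniqueness of Teichmuller digits. -/
theorem eq_of_ghostNull (hR : ∀ x : R, x ^ p ^ n = x) {N : ℕ} {z z' : ℕ → R}
    (h : GhostNull p n N (fun s => WittVector.teichmuller p (z s) - WittVector.teichmuller p (z' s))) : ∀ s < N, z s = z' s := by
  have := perfectRing_of_pow p hR
  intro s
  induction s using Nat.strong_induction_on with
  | _ s ih =>
    intro hs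
    have h1 := h s hs
    have hn : 0 < n := Nat.pos_of_ne_zero (NeZero.ne n)
    have h2 : ghost p n (fun s => WittVector.teichmuller p (z s) - WittVector.teichmuller p (z' s)) s =
        (p : WittVector p R) ^ (s / n) * (WittVector.teichmuller p (z s) - WittVector.teichmuller p (z' s)) := by
      rw [ghost, Finset.sum_eq_single 0]
      · simp
      · intro a ha h0
        have : a * n ≤ s := (Nat.le_div_iff_mul_le hn).1 (by simpa [Nat.lt_succ_iff] using ha)
        have : 0 < a * n := Nat.mul_pos (Nat.pos_of_ne_zero h0) hn
        rw [ih (s - a * n) (by omega) (by omega), sub_self, mul_zero]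
      · simp
    rw [h2] at h1
    have hc : ∀ (m : ℕ) (x : WittVector p R), (p : WittVector p R) ^ m * x = 0 → x = 0 := by
      intro m
      induction m with
      | zero => intro x hx; simpa using hx
      | succ m ihm =>
        intro x hx
        apply ihm
        apply WittVector.eq_zero_of_p_mul_eq_zero (p := p)
        rw [← hx]; ring
    obtain ⟨c, hc'⟩ := h1
    have h3 : (p : WittVector p R) ∣ WittVector.teichmuller p (z s) - WittVector.teichmuller p (z' s) := by
      refine ⟨c, sub_eq_zero.1 (hc (s / n) _ ?_)⟩
      rw [mul_sub, hc', pow_succ]; ring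
    have := coeff_zero_of_dvd p h3
    simpa [WittVector.teichmuller_coeff_zero] using this

/-- The coproduct polynomials compute products of twisted Teichmuller series. -/
theorem coordMul_ghost (hR : ∀ x : R, x ^ p ^ n = x) (x y' : ℕ → R) (N : ℕ) :
    GhostNull p n N (fun s => WittVector.teichmuller p (coordMul p n x y' s) -
      tconv (frob p) (fun j => WittVector.teichmuller p (x j)) (fun j => WittVector.teichmuller p (y' j)) s) := by
  intro s _
  have hn : 0 < n := Nat.pos_of_ne_zero (NeZero.ne n)
  let ev : MvPolynomial (ℕ ⊕ ℕ) ℤ →+* WittVector p R :=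
    MvPolynomial.eval₂Hom (Int.castRingHom _) (Sum.elim (fun j => WittVector.teichmuller p (x j)) (fun j => WittVector.teichmuller p (y' j)))
  have hτ : ∀ (z : R) (a : ℕ), WittVector.teichmuller p z ^ p ^ (a * n) = WittVector.teichmuller p z := by
    intro z a
    induction a with
    | zero => simp
    | succ a ih => rw [add_mul, one_mul, pow_add, pow_mul, ih, ← map_pow, hR]
  have h1 : ghost p n (tconv (frob p) (fun j => WittVector.teichmuller p (x j)) (fun j => WittVector.teichmuller p (y' j))) s =
      ∑ a ∈ range (s / n + 1), (p : WittVector p R) ^ (s / n - a) *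
        ev (comulPoly p n (s - a * n)) ^ p ^ (a * n) := by
    have := congrArg ev (comulPoly_ghost p n s)
    simp only [map_sum, map_mul, map_pow, map_natCast] at this
    rw [this, ghost]
    refine Finset.sum_congr rfl fun a _ => ?_
    congr 1
    refine Finset.sum_congr rfl fun y _ => ?_
    have e1 : ev (MvPolynomial.X (Sum.inl y.1)) = WittVector.teichmuller p (x y.1) := by simp [ev]
    have e2 : ev (MvPolynomial.X (Sum.inr y.2)) = WittVector.teichmuller p (y' y.2) := by simp [ev]
    rw [e1, e2, frob_teichmuller, hτ, pow_add, pow_mul, hτ]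
  change _ ∣ ghost p n ((fun s => WittVector.teichmuller p (coordMul p n x y' s)) -
    tconv (frob p) (fun j => WittVector.teichmuller p (x j)) (fun j => WittVector.teichmuller p (y' j))) s
  rw [ghost_sub, h1, ghost, ← Finset.sum_sub_distrib]
  refine Finset.dvd_sum fun a ha => ?_
  have ha' : a ≤ s / n := by simpa [Nat.lt_succ_iff] using ha
  rw [← mul_sub, show s / n + 1 = (s / n - a) + (a + 1) by omega, pow_add]
  refine mul_dvd_mul_left _ ?_
  have h2 : (p : WittVector p R) ∣ WittVector.teichmuller p (coordMul p n x y' (s - a * n)) - ev (comulPoly p n (s - a * n)) := by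
    apply dvd_of_coeff_zero p hR
    rw [WittVector.teichmuller_coeff_zero]
    change _ = WittVector.constantCoeff _
    simp only [ev, coordMul]
    rw [MvPolynomial.coe_eval₂Hom, MvPolynomial.hom_eval₂]
    congr 1
    · exact RingHom.ext_int _ _
    · funext i
      cases i <;> exact (WittVector.teichmuller_coeff_zero p _).symm
  have h3 := dvd_sub_pow_of_dvd_sub h2 (a * n)
  rw [hτ] at h3
  exact (pow_dvd_pow _ (by nlinarith)).trans h3

theorem coordMul_assoc (hR : ∀ x : R, x ^ p ^ n = x) (x y z : ℕ → R) :
    coordMul p n (coordMul p n x y) z = coordMul p n x (coordMul p n y z) := by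
  funext s
  refine eq_of_ghostNull p hR (N := s + 1) ?_ s (Nat.lt_succ_self s)
  have h1 := coordMul_ghost p hR (coordMul p n x y) z (s + 1)
  have h2 := (coordMul_ghost p hR x y (s + 1)).tconv_right (frob p) (frob_add p) (frob_n p hR)
    (frob_zero p) (fun j => WittVector.teichmuller p (z j))
  have h3 := (coordMul_ghost p hR y z (s + 1)).tconv_left (frob p) (fun j => WittVector.teichmuller p (x j))
  have h4 := coordMul_ghost p hR x (coordMul p n y z) (s + 1)
  have h := ((h1.add h2).add h3.neg).add h4.neg
  convert h using 1
  have e1 := tconv_sub_left (frob p) (fun j => WittVector.teichmuller p (coordMul p n x y j))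
    (tconv (frob p) (fun j => WittVector.teichmuller p (x j)) (fun j => WittVector.teichmuller p (y j))) (fun j => WittVector.teichmuller p (z j))
  have e2 := tconv_sub_right (frob p) (fun j => WittVector.teichmuller p (x j)) (fun j => WittVector.teichmuller p (coordMul p n y z j))
    (tconv (frob p) (fun j => WittVector.teichmuller p (y j)) (fun j => WittVector.teichmuller p (z j)))
  rw [tconv_assoc _ (frob_add p)] at e1
  have e1' := fun s => congrFun e1 s
  have e2' := fun s => congrFun e2 s
  funext i
  have a1 := e1' i
  have a2 := e2' i
  simp only [Pi.sub_apply] at a1 a2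
  simp only [Pi.add_apply, Pi.neg_apply]
  erw [a1, a2]
  ring

/-- The product agrees with a sequence congruent to the twisted convolution -/
theorem coordMul_eq_of_lt (hR : ∀ x : R, x ^ p ^ n = x) (x y z : ℕ → R) (N : ℕ)
    (h : GhostNull p n N (fun s => WittVector.teichmuller p (z s) -
      tconv (frob p) (fun j => WittVector.teichmuller p (x j)) (fun j => WittVector.teichmuller p (y j)) s)) : ∀ s < N, coordMul p n x y s = z s := by
  refine eq_of_ghostNull p hR ?_
  convert (coordMul_ghost p hR x y N).add h.neg using 1
  funext i
  simp only [Pi.add_apply, Pi.neg_apply]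
  ring

theorem ghostNull_zero (N : ℕ) (u : ℕ → WittVector p R) (h : ∀ s, u s = 0) : GhostNull p n N u := by
  intro s _
  simp [ghost, h]

theorem coordMul_one (hR : ∀ x : R, x ^ p ^ n = x) (x : ℕ → R) (s : ℕ) :
    coordMul p n x (fun j => if j = 0 then 1 else 0) s = x s := by
  refine coordMul_eq_of_lt p hR _ _ x (s + 1) (ghostNull_zero p _ _ fun s => ?_) s (Nat.lt_succ_self s)
  rw [tconv, Finset.sum_eq_single (s, 0)]
  · simp
  · rintro ⟨a, b⟩ hab h
    have : b ≠ 0 := by rintro rfl; simp at hab; exact h (by simp [hab])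
    simp [this]
  · simp

theorem one_coordMul (hR : ∀ x : R, x ^ p ^ n = x) (x : ℕ → R) (s : ℕ) :
    coordMul p n (fun j => if j = 0 then 1 else 0) x s = x s := by
  refine coordMul_eq_of_lt p hR _ _ x (s + 1) (ghostNull_zero p _ _ fun s => ?_) s (Nat.lt_succ_self s)
  rw [tconv, Finset.sum_eq_single (0, s)]
  · simp [frob_zero]
  · rintro ⟨a, b⟩ hab h
    have : a ≠ 0 := by rintro rfl; simp at hab; exact h (by simp [hab])
    simp [this]
  · simp

/-- if the coordinates of index strictly between `0` and `k` vanish, the coordinates of the product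
of index `< n + k` are given by the naive formula -/
theorem coordMul_low (hR : ∀ x : R, x ^ p ^ n = x) (x y : ℕ → R) (k : ℕ) (hx0 : x 0 = 1) (hy0 : y 0 = 1)
    (hx : ∀ j, 0 < j → j < k → x j = 0) (hy : ∀ j, 0 < j → j < k → y j = 0) (s : ℕ)
    (hs : s < n + k) :
    coordMul p n x y s = ∑ a ∈ antidiagonal s, x a.1 * y a.2 ^ p ^ a.1 := by
  have hn : 0 < n := Nat.pos_of_ne_zero (NeZero.ne n)
  have hp0 : 0 < p := hp.out.pos
  refine coordMul_eq_of_lt p hR x y (fun s => ∑ a ∈ antidiagonal s, x a.1 * y a.2 ^ p ^ a.1) (n + k)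
    (fun s hs => ?_) s hs
  set u : ℕ → WittVector p R := fun s => WittVector.teichmuller p (∑ a ∈ antidiagonal s, x a.1 * y a.2 ^ p ^ a.1) -
      tconv (frob p) (fun j => WittVector.teichmuller p (x j)) (fun j => WittVector.teichmuller p (y j)) s with hu
  have h1 : ∀ s, (p : WittVector p R) ∣ u s := by
    intro s
    apply dvd_of_coeff_zero p hR
    rw [WittVector.teichmuller_coeff_zero]
    change _ = WittVector.constantCoeff _
    rw [tconv, map_sum]
    refine Finset.sum_congr rfl fun a _ => ?_
    rw [frob_teichmuller, map_mul, map_pow]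
    congr 1
  have h2 : ∀ s < k, u s = 0 := by
    intro s hs
    rcases Nat.eq_zero_or_pos s with rfl | h0
    · simp [hu, tconv, hx0, hy0]
    · have hz : ∀ a ∈ antidiagonal s, x a.1 = 0 ∨ y a.2 = 0 := by
        rintro ⟨a, b⟩ hab
        simp only [HasAntidiagonal.mem_antidiagonal] at hab ⊢
        rcases Nat.eq_zero_or_pos a with rfl | ha
        · right; exact hy b (by omega) (by omega)
        · left; exact hx a ha (by omega)
      have e1 : ∑ a ∈ antidiagonal s, x a.1 * y a.2 ^ p ^ a.1 = 0 := by
        refine Finset.sum_eq_zero fun a ha => ?_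
        rcases hz a ha with h | h
        · simp [h]
        · simp [h, hp0.ne']
      have e2 : tconv (frob p) (fun j => WittVector.teichmuller p (x j)) (fun j => WittVector.teichmuller p (y j)) s = 0 := by
        refine Finset.sum_eq_zero fun a ha => ?_
        rcases hz a ha with h | h <;> simp [h]
      simp only [hu, e1, e2, WittVector.teichmuller_zero, sub_zero]
  rw [ghost, Finset.sum_eq_single 0]
  · simp only [Nat.sub_zero, zero_mul, pow_succ]
    exact mul_dvd_mul_left _ (h1 s)
  · intro a ha h0
    have h3 : a * n ≤ s := (Nat.le_div_iff_mul_le hn).1 (by simpa [Nat.lt_succ_iff] using ha)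
    have : n ≤ a * n := Nat.le_mul_of_pos_left _ (Nat.pos_of_ne_zero h0)
    rw [h2 (s - a * n) (by omega), mul_zero]
  · simp

end Star

section Algebras

variable (p n k : ℕ)

/-- The algebra `S(n,k) = 𝔽_p[t_k, t_{k+1}, ...] / (t_s^{p^n} - t_s)`. -/
def MoravaS : Type :=
  MvPolynomial ({s : ℕ // k ≤ s}) (ZMod p) ⧸
    Ideal.span (Set.range fun s : {s : ℕ // k ≤ s} =>
      (MvPolynomial.X s ^ p ^ n - MvPolynomial.X s : MvPolynomial ({s : ℕ // k ≤ s}) (ZMod p)))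

noncomputable instance : CommRing (MoravaS p n k) :=
  inferInstanceAs (CommRing (MvPolynomial ({s : ℕ // k ≤ s}) (ZMod p) ⧸ Ideal.span _))

noncomputable instance : Algebra (ZMod p) (MoravaS p n k) :=
  inferInstanceAs (Algebra (ZMod p) (MvPolynomial ({s : ℕ // k ≤ s}) (ZMod p) ⧸ Ideal.span _))

/-- The algebra `T(n,k) = 𝔽_p[ξ_k, ..., ξ_{n+k-1}]`. -/
def MoravaT : Type := MvPolynomial {i : ℕ // k ≤ i ∧ i < n + k} (ZMod p)

noncomputable instance : CommRing (MoravaT p n k) :=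
  inferInstanceAs (CommRing (MvPolynomial {i : ℕ // k ≤ i ∧ i < n + k} (ZMod p)))

noncomputable instance : Algebra (ZMod p) (MoravaT p n k) :=
  inferInstanceAs (Algebra (ZMod p) (MvPolynomial {i : ℕ // k ≤ i ∧ i < n + k} (ZMod p)))

/-- The quotient map onto `S(n,k)`. -/
noncomputable def MoravaS.mk : MvPolynomial {s : ℕ // k ≤ s} (ZMod p) →ₐ[ZMod p] MoravaS p n k :=
  Ideal.Quotient.mkₐ (ZMod p) _

/-- The polynomial generator of `T(n,k)`. -/
noncomputable def MoravaT.gen (i : {i : ℕ // k ≤ i ∧ i < n + k}) : MoravaT p n k :=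
  (MvPolynomial.X i : MvPolynomial {i : ℕ // k ≤ i ∧ i < n + k} (ZMod p))

/-- The element `t_s` of `S(n,k)`, with `t_0 = 1` and `t_s = 0` for `0 < s < k`. -/
noncomputable def tElt (s : ℕ) : MoravaS p n k :=
  if s = 0 then 1 else if h : k ≤ s then MoravaS.mk p n k (MvPolynomial.X ⟨s, h⟩) else 0

/-- The element `ξ_i` of `T(n,k)`, with `ξ_0 = 1` and `ξ_i = 0` for `0 < i < k`
(and the irrelevant value `0` for `i ≥ n + k`). -/
noncomputable def xiElt (i : ℕ) : MoravaT p n k :=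
  if i = 0 then 1 else if h : k ≤ i ∧ i < n + k then MoravaT.gen p n k ⟨i, h⟩ else 0

variable {p n k}

theorem tElt_zero : tElt p n k 0 = 1 := by simp [tElt]

theorem tElt_of_lt {s : ℕ} (h0 : 0 < s) (h : s < k) : tElt p n k s = 0 := by
  simp [tElt, h0.ne', not_le.2 h]

theorem xiElt_zero : xiElt p n k 0 = 1 := by simp [xiElt]

theorem xiElt_of_lt {s : ℕ} (h0 : 0 < s) (h : s < k) : xiElt p n k s = 0 := by
  simp [xiElt, h0.ne', not_le.2 h]

/-- algebra maps out of `S` -/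
noncomputable def MoravaS.lift {A : Type*} [CommRing A] [Algebra (ZMod p) A] (f : ℕ → A)
    (hf : ∀ s, f s ^ p ^ n = f s) : MoravaS p n k →ₐ[ZMod p] A :=
  Ideal.Quotient.liftₐ _ (MvPolynomial.aeval fun s : {s : ℕ // k ≤ s} => f s) (by
    intro a ha
    rw [← RingHom.mem_ker]
    refine (Ideal.span_le.2 ?_) ha
    rintro _ ⟨s, rfl⟩
    simp [RingHom.mem_ker, hf])

theorem MoravaS.lift_tElt [NeZero k] {A : Type*} [CommRing A] [Algebra (ZMod p) A] (f : ℕ → A)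
    (hf : ∀ s, f s ^ p ^ n = f s) (h0 : f 0 = 1) (h1 : ∀ s, 0 < s → s < k → f s = 0) (s : ℕ) :
    MoravaS.lift f hf (tElt p n k s) = f s := by
  rcases Nat.eq_zero_or_pos s with rfl | hs
  · rw [tElt_zero, map_one, h0]
  · rcases Nat.lt_or_ge s k with h | h
    · rw [tElt_of_lt hs h, map_zero, h1 s hs h]
    · rw [tElt, if_neg hs.ne', dif_pos h, MoravaS.lift]
      exact MvPolynomial.aeval_X (fun s : {s : ℕ // k ≤ s} => f s) ⟨s, h⟩

theorem MoravaS.algHom_ext [NeZero k] {A : Type*} [CommRing A] [Algebra (ZMod p) A]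
    {f g : MoravaS p n k →ₐ[ZMod p] A} (h : ∀ s, k ≤ s → f (tElt p n k s) = g (tElt p n k s)) :
    f = g := by
  apply Ideal.Quotient.algHom_ext
  apply MvPolynomial.algHom_ext
  rintro ⟨s, hs⟩
  have := h s hs
  have h0 : s ≠ 0 := by
    have := NeZero.ne k
    have : k ≤ s := hs
    omega
  rw [tElt, if_neg h0, dif_pos hs] at this
  exact this

/-- algebra maps out of `T` -/
noncomputable def MoravaT.lift {A : Type*} [CommRing A] [Algebra (ZMod p) A] (f : ℕ → A) :
    MoravaT p n k →ₐ[ZMod p] A :=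
  MvPolynomial.aeval fun s : {i : ℕ // k ≤ i ∧ i < n + k} => f s

theorem MoravaT.lift_xiElt [NeZero k] {A : Type*} [CommRing A] [Algebra (ZMod p) A] (f : ℕ → A)
    (h0 : f 0 = 1) (h1 : ∀ s, 0 < s → s < k → f s = 0) (s : ℕ) (hs' : s < n + k) :
    MoravaT.lift f (xiElt p n k s) = f s := by
  rcases Nat.eq_zero_or_pos s with rfl | hs
  · rw [xiElt_zero, map_one, h0]
  · rcases Nat.lt_or_ge s k with h | h
    · rw [xiElt_of_lt hs h, map_zero, h1 s hs h]
    · rw [xiElt, if_neg hs.ne', dif_pos ⟨h, hs'⟩, MoravaT.lift]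
      exact MvPolynomial.aeval_X (fun s : {i : ℕ // k ≤ i ∧ i < n + k} => f s) ⟨s, h, hs'⟩

theorem MoravaT.algHom_ext [NeZero k] {A : Type*} [CommRing A] [Algebra (ZMod p) A]
    {f g : MoravaT p n k →ₐ[ZMod p] A}
    (h : ∀ s, k ≤ s → s < n + k → f (xiElt p n k s) = g (xiElt p n k s)) :
    f = g := by
  apply MvPolynomial.algHom_ext
  rintro ⟨s, hs⟩
  have := h s hs.1 hs.2
  have h0 : s ≠ 0 := by
    have := NeZero.ne k
    have : k ≤ s := hs.1
    omega
  rw [xiElt, if_neg h0, dif_pos hs] at this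
  exact this

/-! the augmentations -/

variable (p n k) in
/-- The counit of `S(n,k)`: `ε(t_s) = 0`. -/
noncomputable def counitS [Fact p.Prime] : MoravaS p n k →ₐ[ZMod p] ZMod p :=
  MoravaS.lift (fun s => if s = 0 then 1 else 0) (by
    intro s; split_ifs <;> simp)

theorem charP_of_augmentation [Fact p.Prime] {A : Type*} [CommRing A] [Algebra (ZMod p) A]
    (f : A →ₐ[ZMod p] ZMod p) : CharP A p := by
  have : Nontrivial A := f.toRingHom.domain_nontrivial
  exact charP_of_injective_algebraMap (algebraMap (ZMod p) A).injective p

/-- tensor products of augmentations -/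
noncomputable def augTensor {A B : Type*} [CommRing A] [Algebra (ZMod p) A] [CommRing B]
    [Algebra (ZMod p) B] (f : A →ₐ[ZMod p] ZMod p) (g : B →ₐ[ZMod p] ZMod p) :
    A ⊗[ZMod p] B →ₐ[ZMod p] ZMod p :=
  (Algebra.TensorProduct.lmul' (ZMod p)).comp (Algebra.TensorProduct.map f g)

theorem pow_tensor [Fact p.Prime] {A B : Type*} [CommRing A] [Algebra (ZMod p) A] [CommRing B]
    [Algebra (ZMod p) B] [CharP (A ⊗[ZMod p] B) p] (hA : ∀ x : A, x ^ p ^ n = x)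
    (hB : ∀ x : B, x ^ p ^ n = x) (x : A ⊗[ZMod p] B) : x ^ p ^ n = x := by
  induction x using TensorProduct.induction_on with
  | zero => exact zero_pow (pow_ne_zero _ (Fact.out : p.Prime).ne_zero)
  | tmul a b => rw [Algebra.TensorProduct.tmul_pow, hA, hB]
  | add x y hx hy => rw [add_pow_char_pow, hx, hy]

section Inst

variable [Fact p.Prime]

instance : CharP (MoravaS p n k) p := charP_of_augmentation (counitS p n k)

instance : CharP (MoravaS p n k ⊗[ZMod p] MoravaS p n k) p :=
  charP_of_augmentation (augTensor (counitS p n k) (counitS p n k))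

instance : CharP (MoravaS p n k ⊗[ZMod p] (MoravaS p n k ⊗[ZMod p] MoravaS p n k)) p :=
  charP_of_augmentation
    (augTensor (counitS p n k) (augTensor (counitS p n k) (counitS p n k)))

theorem MoravaS.mk_surjective : Function.Surjective (MoravaS.mk p n k) :=
  Ideal.Quotient.mk_surjective

theorem MoravaS.pow_eq (x : MoravaS p n k) : x ^ p ^ n = x := by
  obtain ⟨x, rfl⟩ := MoravaS.mk_surjective x
  induction x using MvPolynomial.induction_on with
  | C a => rw [← map_pow, ← map_pow, ZMod.pow_card_pow]
  | add x y hx hy => rw [map_add, add_pow_char_pow, hx, hy]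
  | mul_X x s hx =>
    rw [map_mul, mul_pow, hx]
    congr 1
    rw [← map_pow]
    exact Ideal.Quotient.eq.2 (Ideal.subset_span ⟨s, rfl⟩)

variable [NeZero n] [NeZero k]

theorem coordMul_low_zero {R : Type*} [CommRing R] [CharP R p] (hR : ∀ x : R, x ^ p ^ n = x)
    (x y : ℕ → R) (hx0 : x 0 = 1) (hy0 : y 0 = 1)
    (hx : ∀ j, 0 < j → j < k → x j = 0) (hy : ∀ j, 0 < j → j < k → y j = 0) :
    coordMul p n x y 0 = 1 ∧ ∀ s, 0 < s → s < k → coordMul p n x y s = 0 := by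
  have hk : 0 < k := Nat.pos_of_ne_zero (NeZero.ne k)
  constructor
  · rw [coordMul_low p hR x y k hx0 hy0 hx hy 0 (by omega)]
    simp [hx0, hy0]
  · intro s h0 hs
    rw [coordMul_low p hR x y k hx0 hy0 hx hy s (by omega)]
    refine Finset.sum_eq_zero fun a ha => ?_
    have ha' : a.1 + a.2 = s := by simpa using ha
    rcases Nat.eq_zero_or_pos a.1 with h | h
    · rw [hy a.2 (by omega) (by omega), zero_pow (pow_ne_zero _ (Fact.out : p.Prime).ne_zero),
        mul_zero]
    · rw [hx a.1 h (by omega), zero_mul]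

variable (p n k)

/-- `Δ(t_s) = Δ_s(t ⊗ 1, 1 ⊗ t)`. -/
noncomputable def comulGenS (s : ℕ) : MoravaS p n k ⊗[ZMod p] MoravaS p n k :=
  MvPolynomial.aeval (Sum.elim (fun i => tElt p n k i ⊗ₜ[ZMod p] (1 : MoravaS p n k))
    (fun j => (1 : MoravaS p n k) ⊗ₜ[ZMod p] tElt p n k j)) (comulPoly p n s)

theorem comulGenS_eq (s : ℕ) : comulGenS p n k s =
    coordMul p n (fun i => tElt p n k i ⊗ₜ[ZMod p] (1 : MoravaS p n k))
      (fun j => (1 : MoravaS p n k) ⊗ₜ[ZMod p] tElt p n k j) s := rfl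

/-- The coproduct of `S(n,k)`. -/
noncomputable def comulS : MoravaS p n k →ₐ[ZMod p] MoravaS p n k ⊗[ZMod p] MoravaS p n k :=
  MoravaS.lift (comulGenS p n k) (fun _ => pow_tensor MoravaS.pow_eq MoravaS.pow_eq _)

theorem comulS_tElt (s : ℕ) : comulS p n k (tElt p n k s) = comulGenS p n k s := by
  have h := coordMul_low_zero (k := k) (p := p) (n := n) (pow_tensor MoravaS.pow_eq MoravaS.pow_eq)
      (fun i => tElt p n k i ⊗ₜ[ZMod p] (1 : MoravaS p n k))
      (fun j => (1 : MoravaS p n k) ⊗ₜ[ZMod p] tElt p n k j)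
      (by simp [tElt_zero, Algebra.TensorProduct.one_def])
      (by simp [tElt_zero, Algebra.TensorProduct.one_def])
      (fun j h0 h => by simp [tElt_of_lt h0 h]) (fun j h0 h => by simp [tElt_of_lt h0 h])
  exact MoravaS.lift_tElt _ _ h.1 h.2 s

theorem counitS_tElt (s : ℕ) : counitS p n k (tElt p n k s) = if s = 0 then 1 else 0 :=
  MoravaS.lift_tElt _ _ (by simp) (fun s h0 _ => by simp [h0.ne']) s

/-- `S(n,k)` as a Hopf algebra. -/
noncomputable instance instBialgebraS : Bialgebra (ZMod p) (MoravaS p n k) :=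
  Bialgebra.ofAlgHom (comulS p n k) (counitS p n k)
    (by
      have h3 : ∀ x : MoravaS p n k ⊗[ZMod p] (MoravaS p n k ⊗[ZMod p] MoravaS p n k),
          x ^ p ^ n = x := pow_tensor MoravaS.pow_eq (pow_tensor MoravaS.pow_eq MoravaS.pow_eq)
      apply MoravaS.algHom_ext
      intro s _
      simp only [AlgHom.comp_apply]
      rw [comulS_tElt, comulGenS_eq]
      have e1 := map_coordMul p n (((Algebra.TensorProduct.assoc (ZMod p) (ZMod p) (ZMod p)
        (MoravaS p n k) (MoravaS p n k) (MoravaS p n k)).toAlgHom.comp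
        (Algebra.TensorProduct.map (comulS p n k) (.id (ZMod p) (MoravaS p n k)))).toRingHom)
        (fun i => tElt p n k i ⊗ₜ[ZMod p] (1 : MoravaS p n k))
        (fun j => (1 : MoravaS p n k) ⊗ₜ[ZMod p] tElt p n k j) s
      have e2 := map_coordMul p n
        (Algebra.TensorProduct.map (.id (ZMod p) (MoravaS p n k)) (comulS p n k)).toRingHom
        (fun i => tElt p n k i ⊗ₜ[ZMod p] (1 : MoravaS p n k))
        (fun j => (1 : MoravaS p n k) ⊗ₜ[ZMod p] tElt p n k j) s
      refine e1.trans (Eq.trans ?_ e2.symm)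
      let x : ℕ → MoravaS p n k ⊗[ZMod p] (MoravaS p n k ⊗[ZMod p] MoravaS p n k) :=
        fun i => tElt p n k i ⊗ₜ 1
      let y : ℕ → MoravaS p n k ⊗[ZMod p] (MoravaS p n k ⊗[ZMod p] MoravaS p n k) :=
        fun i => 1 ⊗ₜ (tElt p n k i ⊗ₜ 1)
      let z : ℕ → MoravaS p n k ⊗[ZMod p] (MoravaS p n k ⊗[ZMod p] MoravaS p n k) :=
        fun i => 1 ⊗ₜ (1 ⊗ₜ tElt p n k i)
      have key := congrFun (coordMul_assoc p h3 x y z) s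
      convert key using 2
      · funext i
        change Algebra.TensorProduct.assoc (ZMod p) (ZMod p) (ZMod p) _ _ _
          (comulS p n k (tElt p n k i) ⊗ₜ 1) = _
        rw [comulS_tElt, comulGenS_eq]
        have := map_coordMul p n (((Algebra.TensorProduct.assoc (ZMod p) (ZMod p) (ZMod p)
          (MoravaS p n k) (MoravaS p n k) (MoravaS p n k)).toAlgHom.comp
          (Algebra.TensorProduct.includeLeft)).toRingHom)
          (fun i => tElt p n k i ⊗ₜ[ZMod p] (1 : MoravaS p n k))
          (fun j => (1 : MoravaS p n k) ⊗ₜ[ZMod p] tElt p n k j) i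
        exact this
      · funext i
        change Algebra.TensorProduct.assoc (ZMod p) (ZMod p) (ZMod p) _ _ _
          (comulS p n k 1 ⊗ₜ _) = _
        rw [map_one, Algebra.TensorProduct.one_def]
        rfl
      · funext i
        change (tElt p n k i ⊗ₜ comulS p n k 1) = _
        rw [map_one]
      · funext i
        change 1 ⊗ₜ comulS p n k (tElt p n k i) = _
        rw [comulS_tElt, comulGenS_eq]
        exact map_coordMul p n (Algebra.TensorProduct.includeRight (R := ZMod p)
          (A := MoravaS p n k) (B := MoravaS p n k ⊗[ZMod p] MoravaS p n k)).toRingHom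
          (fun i => tElt p n k i ⊗ₜ[ZMod p] (1 : MoravaS p n k))
          (fun j => (1 : MoravaS p n k) ⊗ₜ[ZMod p] tElt p n k j) i)
    (by
      apply MoravaS.algHom_ext
      intro s _
      simp only [AlgHom.comp_apply]
      rw [comulS_tElt, comulGenS_eq]
      have e := map_coordMul p n (((Algebra.TensorProduct.lid (ZMod p) (MoravaS p n k)).toAlgHom.comp
        (Algebra.TensorProduct.map (counitS p n k) (.id (ZMod p) (MoravaS p n k)))).toRingHom)
        (fun i => tElt p n k i ⊗ₜ[ZMod p] (1 : MoravaS p n k))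
        (fun j => (1 : MoravaS p n k) ⊗ₜ[ZMod p] tElt p n k j) s
      apply (Algebra.TensorProduct.lid (ZMod p) (MoravaS p n k)).injective
      refine e.trans ?_
      have key := one_coordMul p MoravaS.pow_eq (tElt p n k) s
      refine Eq.trans ?_ (key.trans ?_)
      · congr 1
        · funext i
          change Algebra.TensorProduct.lid (ZMod p) (MoravaS p n k)
            (counitS p n k (tElt p n k i) ⊗ₜ 1) = _
          rw [counitS_tElt]
          split_ifs <;> simp
        · funext i
          change Algebra.TensorProduct.lid (ZMod p) (MoravaS p n k)
            (counitS p n k 1 ⊗ₜ tElt p n k i) = _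
          simp
      · simp)
    (by
      apply MoravaS.algHom_ext
      intro s _
      simp only [AlgHom.comp_apply]
      rw [comulS_tElt, comulGenS_eq]
      have e := map_coordMul p n (((Algebra.TensorProduct.rid (ZMod p) (ZMod p)
        (MoravaS p n k)).toAlgHom.comp
        (Algebra.TensorProduct.map (.id (ZMod p) (MoravaS p n k)) (counitS p n k))).toRingHom)
        (fun i => tElt p n k i ⊗ₜ[ZMod p] (1 : MoravaS p n k))
        (fun j => (1 : MoravaS p n k) ⊗ₜ[ZMod p] tElt p n k j) s
      apply (Algebra.TensorProduct.rid (ZMod p) (ZMod p) (MoravaS p n k)).injective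
      refine e.trans ?_
      have key := coordMul_one p MoravaS.pow_eq (tElt p n k) s
      refine Eq.trans ?_ (key.trans ?_)
      · congr 1
        · funext i
          change Algebra.TensorProduct.rid (ZMod p) (ZMod p) (MoravaS p n k)
            (tElt p n k i ⊗ₜ counitS p n k 1) = _
          simp
        · funext i
          change Algebra.TensorProduct.rid (ZMod p) (ZMod p) (MoravaS p n k)
            (1 ⊗ₜ counitS p n k (tElt p n k i)) = _
          rw [counitS_tElt]
          split_ifs <;> simp
      · simp)

end Inst

end Algebras

section AlgebraT

variable (p n k : ℕ) [Fact p.Prime]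

/-- The counit of `T(n,k)`: `ε(ξ_i) = 0`. -/
noncomputable def counitT : MoravaT p n k →ₐ[ZMod p] ZMod p :=
  MoravaT.lift (fun i => if i = 0 then 1 else 0)

instance : CharP (MoravaT p n k) p := charP_of_augmentation (counitT p n k)

instance : CharP (MoravaT p n k ⊗[ZMod p] MoravaT p n k) p :=
  charP_of_augmentation (augTensor (counitT p n k) (counitT p n k))

/-- `Δ(ξ_i) = ∑_{a+b=i} ξ_a ⊗ ξ_b^{p^a}`; as `ξ_0 = 1` and `ξ_a = 0` for `0 < a < k`, this is
`ξ_i ⊗ 1 + ∑_{k ≤ a ≤ i-k} ξ_a ⊗ ξ_{i-a}^{p^a} + 1 ⊗ ξ_i`. -/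
noncomputable def comulGenT (i : ℕ) : MoravaT p n k ⊗[ZMod p] MoravaT p n k :=
  ∑ x ∈ antidiagonal i, xiElt p n k x.1 ⊗ₜ[ZMod p] (xiElt p n k x.2 ^ p ^ x.1)

/-- The coproduct of `T(n,k)`. -/
noncomputable def comulT : MoravaT p n k →ₐ[ZMod p] MoravaT p n k ⊗[ZMod p] MoravaT p n k :=
  MoravaT.lift (comulGenT p n k)

variable [NeZero k]

theorem comulT_xiElt (i : ℕ) (hi : i < n + k) :
    comulT p n k (xiElt p n k i) = comulGenT p n k i := by
  have hp0 : p ≠ 0 := (Fact.out : p.Prime).ne_zero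
  refine MoravaT.lift_xiElt _ ?_ ?_ i hi
  · simp [comulGenT, xiElt_zero, Algebra.TensorProduct.one_def]
  · intro s h0 hs
    refine Finset.sum_eq_zero fun a ha => ?_
    have ha' : a.1 + a.2 = s := by simpa using ha
    rcases Nat.eq_zero_or_pos a.1 with h | h
    · rw [xiElt_of_lt (s := a.2) (by omega) (by omega), zero_pow (pow_ne_zero _ hp0),
        TensorProduct.tmul_zero]
    · rw [xiElt_of_lt (s := a.1) (by omega) (by omega), TensorProduct.zero_tmul]

theorem counitT_xiElt (i : ℕ) (hi : i < n + k) :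
    counitT p n k (xiElt p n k i) = if i = 0 then 1 else 0 :=
  MoravaT.lift_xiElt _ (by simp) (fun s h0 _ => by simp [h0.ne']) i hi

/-- `T(n,k)` as a Hopf algebra. -/
noncomputable instance instBialgebraT : Bialgebra (ZMod p) (MoravaT p n k) :=
  Bialgebra.ofAlgHom (comulT p n k) (counitT p n k)
    (by
      apply MoravaT.algHom_ext
      intro s _ hs
      simp only [AlgHom.comp_apply]
      rw [comulT_xiElt p n k s hs, comulGenT]
      simp only [map_sum, Algebra.TensorProduct.map_tmul, AlgHom.id_apply, map_pow]
      have e1 : ∀ x ∈ antidiagonal s, (Algebra.TensorProduct.assoc (ZMod p) (ZMod p) (ZMod p)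
          (MoravaT p n k) (MoravaT p n k) (MoravaT p n k)).toAlgHom
            (comulT p n k (xiElt p n k x.1) ⊗ₜ (xiElt p n k x.2 ^ p ^ x.1)) =
          ∑ y ∈ antidiagonal x.1, xiElt p n k y.1 ⊗ₜ ((xiElt p n k y.2 ^ p ^ y.1) ⊗ₜ
            (xiElt p n k x.2 ^ p ^ x.1)) := by
        intro x hx
        have hx' : x.1 + x.2 = s := by simpa using hx
        rw [comulT_xiElt p n k x.1 (by omega), comulGenT, TensorProduct.sum_tmul, map_sum]
        rfl
      have e2 : ∀ x ∈ antidiagonal s, xiElt p n k x.1 ⊗ₜ[ZMod p]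
          (comulT p n k (xiElt p n k x.2) ^ p ^ x.1) =
          ∑ y ∈ antidiagonal x.2, xiElt p n k x.1 ⊗ₜ ((xiElt p n k y.1 ^ p ^ x.1) ⊗ₜ
            (xiElt p n k y.2 ^ p ^ (y.1 + x.1))) := by
        intro x hx
        have hx' : x.1 + x.2 = s := by simpa using hx
        rw [comulT_xiElt p n k x.2 (by omega), comulGenT, sum_pow_char_pow,
          TensorProduct.tmul_sum]
        refine Finset.sum_congr rfl fun y _ => ?_
        rw [Algebra.TensorProduct.tmul_pow, ← pow_mul, ← pow_add]
      rw [Finset.sum_congr rfl e1, Finset.sum_congr rfl e2, Finset.sum_sigma', Finset.sum_sigma']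
      refine Finset.sum_nbij' (fun x => ⟨(x.2.1, x.2.2 + x.1.2), (x.2.2, x.1.2)⟩)
        (fun x => ⟨(x.1.1 + x.2.1, x.2.2), (x.1.1, x.2.1)⟩) ?_ ?_ ?_ ?_ ?_
      · rintro ⟨⟨a, b⟩, ⟨c, d⟩⟩ h; simp at h ⊢; omega
      · rintro ⟨⟨a, b⟩, ⟨c, d⟩⟩ h; simp at h ⊢; omega
      · rintro ⟨⟨a, b⟩, ⟨c, d⟩⟩ h; simp at h ⊢; obtain ⟨h, rfl⟩ := h; simp
      · rintro ⟨⟨a, b⟩, ⟨c, d⟩⟩ h; simp at h ⊢; obtain ⟨h, rfl⟩ := h; simp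
      · rintro ⟨⟨a, b⟩, ⟨c, d⟩⟩ h
        simp at h ⊢; obtain ⟨h, rfl⟩ := h
        rw [add_comm c d])
    (by
      apply MoravaT.algHom_ext
      intro s _ hs
      simp only [AlgHom.comp_apply]
      rw [comulT_xiElt p n k s hs, comulGenT, map_sum, Finset.sum_eq_single (0, s)]
      · rw [Algebra.TensorProduct.map_tmul, counitT_xiElt p n k 0 (by omega)]
        simp
      · rintro ⟨a, b⟩ hab h
        have hab' : a + b = s := by simpa using hab
        have : a ≠ 0 := by rintro rfl; exact h (by simp at hab'; simp [hab'])
        rw [Algebra.TensorProduct.map_tmul, counitT_xiElt p n k a (by omega)]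
        simp [this]
      · simp)
    (by
      apply MoravaT.algHom_ext
      intro s _ hs
      simp only [AlgHom.comp_apply]
      have hp0 : p ≠ 0 := (Fact.out : p.Prime).ne_zero
      rw [comulT_xiElt p n k s hs, comulGenT, map_sum, Finset.sum_eq_single (s, 0)]
      · rw [Algebra.TensorProduct.map_tmul, map_pow, counitT_xiElt p n k 0 (by omega)]
        simp
      · rintro ⟨a, b⟩ hab h
        have hab' : a + b = s := by simpa using hab
        have : b ≠ 0 := by rintro rfl; exact h (by simp at hab'; simp [hab'])
        rw [Algebra.TensorProduct.map_tmul, map_pow, counitT_xiElt p n k b (by omega)]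
        simp [this, hp0]
      · simp)

variable [NeZero n]

/-- The reduction map `Φ : T(n,k) → S(n,k)`, `ξ_i ↦ t_i`, a map of Hopf algebras. -/
noncomputable def reductionMap : MoravaT p n k →ₐc[ZMod p] MoravaS p n k :=
  BialgHom.ofAlgHom (MoravaT.lift (tElt p n k))
    (by
      apply MoravaT.algHom_ext
      intro s _ hs
      rw [AlgHom.comp_apply, MoravaT.lift_xiElt _ tElt_zero (fun s h0 h => tElt_of_lt h0 h) s hs]
      exact (counitS_tElt p n k s).trans (counitT_xiElt p n k s hs).symm)
    (by
      apply MoravaT.algHom_ext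
      intro s _ hs
      have h1 : ∀ s < n + k, MoravaT.lift (tElt p n k) (xiElt p n k s) = tElt p n k s :=
        MoravaT.lift_xiElt _ tElt_zero (fun s h0 h => tElt_of_lt h0 h)
      rw [AlgHom.comp_apply, AlgHom.comp_apply, h1 s hs]
      refine Eq.trans ?_ (comulS_tElt p n k s).symm
      refine (congrArg _ (comulT_xiElt p n k s hs)).trans ?_
      rw [comulGenT, map_sum, comulGenS_eq, coordMul_low p (pow_tensor MoravaS.pow_eq MoravaS.pow_eq)
        (fun i => tElt p n k i ⊗ₜ[ZMod p] (1 : MoravaS p n k))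
        (fun j => (1 : MoravaS p n k) ⊗ₜ[ZMod p] tElt p n k j) k
        (by simp [tElt_zero, Algebra.TensorProduct.one_def])
        (by simp [tElt_zero, Algebra.TensorProduct.one_def])
        (fun j h0 h => by simp [tElt_of_lt h0 h]) (fun j h0 h => by simp [tElt_of_lt h0 h]) s hs]
      refine Finset.sum_congr rfl fun x hx => ?_
      have hx' : x.1 + x.2 = s := by simpa using hx
      rw [Algebra.TensorProduct.map_tmul, map_pow, h1 _ (by omega), h1 _ (by omega),
        Algebra.TensorProduct.tmul_pow, Algebra.TensorProduct.tmul_mul_tmul]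
      simp)

end AlgebraT

section Cobar

variable (R A : Type*) [CommRing R] [CommRing A] [Bialgebra R A]

/-- The augmentation ideal `Ā = Ker ε`. -/
abbrev AugIdeal : Submodule R A := LinearMap.ker (Coalgebra.counit (R := R) (A := A))

/-- The projection `A → Ā`, `a ↦ a - ε(a)`. -/
noncomputable def augProj : A →ₗ[R] AugIdeal R A :=
  (LinearMap.id - (Algebra.linearMap R A).comp Coalgebra.counit).codRestrict _ (by
    intro a
    simp [LinearMap.mem_ker, Algebra.algebraMap_eq_smul_one])

/-- The cobar construction `⨁_s Ā^{⊗ s}`, with the concatenation product. -/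
abbrev Cobar : Type _ := TensorAlgebra R (AugIdeal R A)

variable {A}

/-- The element `[a]` of length one; `[a] = [a - ε(a)]`, so `[1] = 0`. -/
noncomputable def bar : A →ₗ[R] Cobar R A := (TensorAlgebra.ι R).comp (augProj R A)

variable (A)

/-- `a ↦ ∑ [a'|a'']`, where `Δ a = ∑ a' ⊗ a''`.  On the augmentation ideal this is the
reduced coproduct `Δ a - a ⊗ 1 - 1 ⊗ a`. -/
noncomputable def redComul : A →ₗ[R] Cobar R A :=
  (LinearMap.mul' R (Cobar R A)).comp
    ((TensorProduct.map (bar R) (bar R)).comp Coalgebra.comul)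

/-- Auxiliary: the algebra map `x ↦ !![(-1)^s x, d x; 0, x]`, determined on elements of length one
by `d [a] = -(reduced coproduct of a)`. -/
noncomputable def cobarAux : Cobar R A →ₐ[R] Matrix (Fin 2) (Fin 2) (Cobar R A) :=
  TensorAlgebra.lift R
    { toFun := fun v => !![-TensorAlgebra.ι R v, -redComul R A v; 0, TensorAlgebra.ι R v]
      map_add' := fun v w => by
        ext i j; fin_cases i <;> fin_cases j <;> simp [add_comm]
      map_smul' := fun c v => by
        ext i j; fin_cases i <;> fin_cases j <;> simp }

/-- The sign automorphism `x ↦ (-1)^s x`. -/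
noncomputable def cobarSign : Cobar R A →ₐ[R] Cobar R A :=
  TensorAlgebra.lift R (-TensorAlgebra.ι R)

/-- The cobar differential
`d [a_1|...|a_s] = ∑_i (-1)^i [a_1|...|Δ a_i - a_i ⊗ 1 - 1 ⊗ a_i|...|a_s]`: the signed derivation
(`cobarD_mul`) with `d [a] = -[reduced coproduct of a]` (`cobarD_ι`). -/
noncomputable def cobarD : Cobar R A →ₗ[R] Cobar R A :=
  (Matrix.entryLinearMap R (Cobar R A) 0 1).comp (cobarAux R A).toLinearMap

variable {R A}

theorem cobarAux_eq (x : Cobar R A) :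
    cobarAux R A x = !![cobarSign R A x, cobarD R A x; 0, x] := by
  have hd : cobarD R A x = cobarAux R A x 0 1 := rfl
  have h : cobarAux R A x 0 0 = cobarSign R A x ∧ cobarAux R A x 1 0 = 0 ∧
      cobarAux R A x 1 1 = x := by
    clear hd
    induction x using TensorAlgebra.induction with
    | algebraMap r => simp [Matrix.algebraMap_matrix_apply]
    | ι v => simp [cobarAux, cobarSign]
    | mul x y hx hy => simp [Matrix.mul_apply, Fin.sum_univ_two, hx, hy]
    | add x y hx hy => simp [hx, hy]
  rw [hd]
  ext i j; fin_cases i <;> fin_cases j <;> simp [h]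

theorem cobarD_mul (x y : Cobar R A) :
    cobarD R A (x * y) = cobarD R A x * y + cobarSign R A x * cobarD R A y := by
  have h := congrFun (congrFun (map_mul (cobarAux R A) x y) 0) 1
  rw [cobarAux_eq, cobarAux_eq x, cobarAux_eq y] at h
  simp [Matrix.mul_apply, Fin.sum_univ_two] at h
  rw [h, add_comm]

theorem cobarD_algebraMap (r : R) : cobarD R A (algebraMap R _ r) = 0 := by
  simp [cobarD, Matrix.algebraMap_matrix_apply]

theorem cobarD_ι (v : AugIdeal R A) : cobarD R A (TensorAlgebra.ι R v) = -redComul R A v := by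
  simp [cobarD, cobarAux]

theorem bar_one : bar R (1 : A) = 0 := by
  have : augProj R A 1 = 0 := by
    apply Subtype.ext
    simp [augProj]
  rw [bar, LinearMap.comp_apply, this, map_zero]

theorem bar_algebraMap (r : R) : bar R (algebraMap R A r) = 0 := by
  rw [Algebra.algebraMap_eq_smul_one, map_smul, bar_one, smul_zero]

theorem redComul_algebraMap (r : R) : redComul R A (algebraMap R A r) = 0 := by
  simp [redComul, Algebra.algebraMap_eq_smul_one, Algebra.TensorProduct.one_def, bar_one]

theorem cobarD_bar (a : A) : cobarD R A (bar R a) = -redComul R A a := by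
  rw [bar, LinearMap.comp_apply, cobarD_ι]
  congr 1
  have : (augProj R A a : A) = a - algebraMap R A (Coalgebra.counit a) := by simp [augProj]
  rw [this, map_sub, redComul_algebraMap, sub_zero]

theorem cobarSign_bar (a : A) : cobarSign R A (bar R a) = -bar R a := by
  simp [bar, cobarSign]

theorem cobarD_redComul (a : A) : cobarD R A (redComul R A a) = 0 := by
  let m := LinearMap.mul' R (Cobar R A)
  have h1 : (cobarD R A).comp (m.comp (TensorProduct.map (bar R) (bar R))) =
      m.comp (TensorProduct.map (bar R) (redComul R A)) -
        m.comp (TensorProduct.map (redComul R A) (bar R)) := by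
    apply TensorProduct.ext'
    intro x y
    simp [m, cobarD_mul, cobarD_bar, cobarSign_bar]
    abel
  have h2 : cobarD R A (redComul R A a) = ((cobarD R A).comp
      (m.comp (TensorProduct.map (bar R) (bar R)))) (Coalgebra.comul a) := rfl
  rw [h2, h1, LinearMap.sub_apply, sub_eq_zero]
  have e1 : m.comp (TensorProduct.map (bar R) (redComul R A)) =
      (m.comp (TensorProduct.map (bar R) (m.comp (TensorProduct.map (bar R) (bar R))))).comp
        (LinearMap.lTensor A Coalgebra.comul) := by
    apply TensorProduct.ext'
    intro x y
    simp [m, redComul]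
  have e2 : m.comp (TensorProduct.map (redComul R A) (bar R)) =
      (m.comp (TensorProduct.map (m.comp (TensorProduct.map (bar R) (bar R))) (bar R))).comp
        (LinearMap.rTensor A Coalgebra.comul) := by
    apply TensorProduct.ext'
    intro x y
    simp [m, redComul]
  have e3 : (m.comp (TensorProduct.map (m.comp (TensorProduct.map (bar R) (bar R))) (bar R))) =
      (m.comp (TensorProduct.map (bar R) (m.comp (TensorProduct.map (bar R) (bar R))))).comp
        (TensorProduct.assoc R A A A).toLinearMap := by
    apply TensorProduct.ext_threefold
    intro x y z
    simp [m, mul_assoc]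
  rw [e2, e3, e1]
  simp only [LinearMap.comp_apply]
  rw [← Coalgebra.coassoc_apply]
  rfl

theorem cobarD_sign (x : Cobar R A) :
    cobarD R A (cobarSign R A x) = -cobarSign R A (cobarD R A x) := by
  induction x using TensorAlgebra.induction with
  | algebraMap r => simp [cobarD_algebraMap]
  | ι v =>
    have h : ∀ a : A, cobarSign R A (redComul R A a) = redComul R A a := by
      intro a
      have : (cobarSign R A).toLinearMap.comp ((LinearMap.mul' R (Cobar R A)).comp
          (TensorProduct.map (bar R) (bar R))) = (LinearMap.mul' R (Cobar R A)).comp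
          (TensorProduct.map (bar R) (bar R)) := by
        apply TensorProduct.ext'
        intro x y
        simp [cobarSign_bar]
      exact LinearMap.congr_fun this (Coalgebra.comul a)
    have h2 : cobarSign R A (TensorAlgebra.ι R v) = -TensorAlgebra.ι R v := by simp [cobarSign]
    rw [h2, map_neg, cobarD_ι, map_neg, h]
  | mul x y hx hy =>
    have hss : ∀ x, cobarSign R A (cobarSign R A x) = x := by
      intro x
      have : (cobarSign R A).comp (cobarSign R A) = AlgHom.id R _ := by
        apply TensorAlgebra.hom_ext
        ext v
        simp [cobarSign]
      exact DFunLike.congr_fun this x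
    simp only [map_mul, cobarD_mul, map_add, hx, hy, hss]
    noncomm_ring
  | add x y hx hy => simp only [map_add, hx, hy]; abel

theorem cobarD_cobarD (x : Cobar R A) : cobarD R A (cobarD R A x) = 0 := by
  induction x using TensorAlgebra.induction with
  | algebraMap r => simp [cobarD_algebraMap]
  | ι v => rw [cobarD_ι, map_neg, cobarD_redComul, neg_zero]
  | mul x y hx hy =>
    have hss : ∀ x, cobarSign R A (cobarSign R A x) = x := by
      intro x
      have : (cobarSign R A).comp (cobarSign R A) = AlgHom.id R _ := by
        apply TensorAlgebra.hom_ext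
        ext v
        simp [cobarSign]
      exact DFunLike.congr_fun this x
    simp only [cobarD_mul, map_add, hx, hy, cobarD_sign, zero_mul, mul_zero]
    noncomm_ring
  | add x y hx hy => rw [map_add, map_add, hx, hy, add_zero]

/-- The map of cobar constructions induced by a map of bialgebras. -/
noncomputable def cobarMap {B : Type*} [CommRing B] [Bialgebra R B] (f : A →ₐc[R] B) :
    Cobar R A →ₐ[R] Cobar R B :=
  TensorAlgebra.lift R ((TensorAlgebra.ι R).comp
    ((f : A →ₗ[R] B).restrict (p := AugIdeal R A) (q := AugIdeal R B) (fun a ha => by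
      rw [LinearMap.mem_ker] at ha ⊢
      rw [← ha]
      exact CoalgHomClass.counit_comp_apply f a)))

end Cobar

section SpectralSequence

/-- A differential algebra `C` with subspaces `F s t M` of elements of homological degree `s`, inner
degree `t` and filtration `≤ M`. -/
structure FilteredDGA (R C : Type*) [CommRing R] [Ring C] [Algebra R C] where
  d : C →ₗ[R] C
  d_d : ∀ x, d (d x) = 0
  F : ℤ → ℤ → ℤ → Submodule R C
  F_mono : ∀ s t {M M' : ℤ}, M ≤ M' → F s t M ≤ F s t M'
  F_mul : ∀ {s t M s' t' M' : ℤ} {x y : C}, x ∈ F s t M → y ∈ F s' t' M' →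
    x * y ∈ F (s + s') (t + t') (M + M')
  leibniz : ∀ {s t M : ℤ} {x : C}, x ∈ F s t M → ∀ y,
    d (x * y) = d x * y + Int.negOnePow s • (x * d y)

namespace FilteredDGA

variable {R C : Type*} [CommRing R] [Ring C] [Algebra R C] (X : FilteredDGA R C)

/-- `Z_r^{s,t,M} = {z ∈ F^M C^{s,t} : d z ∈ F^{M-r} C^{s+1,t}}`. -/
def Z (r s t M : ℤ) : Submodule R C := X.F s t M ⊓ (X.F (s + 1) t (M - r)).comap X.d

/-- `B_r^{s,t,M} = Z_{r-1}^{s,t,M-1} + d Z_{r-1}^{s-1,t,M+r-1}`. -/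
def B (r s t M : ℤ) : Submodule R C :=
  X.Z (r - 1) s t (M - 1) ⊔ (X.Z (r - 1) (s - 1) t (M + r - 1)).map X.d

/-- The page `E_r^{s,t,M} = Z_r^{s,t,M} / B_r^{s,t,M}` of the spectral sequence of the increasing
filtration. -/
abbrev E (r : ℕ) (s t M : ℤ) : Type _ :=
  X.Z r s t M ⧸ (X.B r s t M).submoduleOf (X.Z r s t M)

/-- The class in `E_r^{s,t,M}` of an element of `Z_r^{s,t,M}`. -/
def cls (r : ℕ) (s t M : ℤ) (z : C) (hz : z ∈ X.Z r s t M) : X.E r s t M :=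
  Submodule.Quotient.mk ⟨z, hz⟩

theorem d_mem_Z {r s t M : ℤ} {z : C} (hz : z ∈ X.Z r s t M) :
    X.d z ∈ X.Z r (s + 1) t (M - r) :=
  ⟨hz.2, by
    change X.d (X.d z) ∈ X.F (s + 1 + 1) t (M - r - r)
    rw [X.d_d]; exact Submodule.zero_mem _⟩

theorem d_mem_B {r s t M : ℤ} {z : C} (hz : z ∈ X.B r s t M) :
    X.d z ∈ X.B r (s + 1) t (M - r) := by
  obtain ⟨x, hx, y, hy, rfl⟩ := Submodule.mem_sup.1 hz
  obtain ⟨w, -, rfl⟩ := hy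
  rw [map_add, X.d_d, add_zero]
  refine Submodule.mem_sup_right ⟨x, ?_, rfl⟩
  rw [add_sub_cancel_right, show M - r + r - 1 = M - 1 by ring]
  exact hx

/-- The differential `d_r : E_r^{s,t,M} → E_r^{s+1,t,M-r}`, induced by `d`. -/
noncomputable def dE (r : ℕ) (s t M : ℤ) : X.E r s t M →ₗ[R] X.E r (s + 1) t (M - r) :=
  Submodule.mapQ _ _ (X.d.restrict fun _ hz => X.d_mem_Z hz) (fun _ hz => X.d_mem_B hz)

theorem negOnePow_smul_mem (P : Submodule R C) (s : ℤ) {x : C} (hx : x ∈ P) :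
    Int.negOnePow s • x ∈ P := by
  rcases Int.even_or_odd s with h | h
  · rwa [Int.negOnePow_even s h, one_smul]
  · rw [Int.negOnePow_odd s h, Units.neg_smul, one_smul]; exact Submodule.neg_mem _ hx

theorem mul_mem_Z {r s t M s' t' M' : ℤ} {x y : C} (hx : x ∈ X.Z r s t M)
    (hy : y ∈ X.Z r s' t' M') : x * y ∈ X.Z r (s + s') (t + t') (M + M') := by
  refine ⟨X.F_mul hx.1 hy.1, ?_⟩
  change X.d (x * y) ∈ X.F (s + s' + 1) (t + t') (M + M' - r)
  rw [X.leibniz hx.1]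
  refine Submodule.add_mem _ ?_ (negOnePow_smul_mem _ _ ?_)
  · have := X.F_mul hx.2 hy.1
    rwa [show s + 1 + s' = s + s' + 1 by ring, show M - r + M' = M + M' - r by ring] at this
  · have := X.F_mul hx.1 hy.2
    rwa [show s + (s' + 1) = s + s' + 1 by ring, show M + (M' - r) = M + M' - r by ring] at this

theorem Z_le_Z {r r' s t M M' : ℤ} (h1 : M ≤ M') (h2 : M - r ≤ M' - r') :
    X.Z r s t M ≤ X.Z r' s t M' :=
  fun _ hx => ⟨X.F_mono s t h1 hx.1, X.F_mono (s + 1) t h2 hx.2⟩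

theorem mul_mem_B_left {r s t M s' t' M' : ℤ} {x y : C} (hx : x ∈ X.B r s t M)
    (hy : y ∈ X.Z r s' t' M') : x * y ∈ X.B r (s + s') (t + t') (M + M') := by
  have hy' : y ∈ X.Z (r - 1) s' t' M' := X.Z_le_Z le_rfl (by linarith) hy
  have hdy : X.d y ∈ X.Z (r - 1) (s' + 1) t' (M' - r) :=
    X.Z_le_Z le_rfl (by linarith) (X.d_mem_Z hy)
  obtain ⟨u, hu, v, ⟨w, hw, rfl⟩, rfl⟩ := Submodule.mem_sup.1 hx
  rw [add_mul]
  refine Submodule.add_mem _ (Submodule.mem_sup_left ?_) ?_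
  · have := X.mul_mem_Z hu hy'
    rwa [show M - 1 + M' = M + M' - 1 by ring] at this
  · have h1 : X.d w * y = X.d (w * y) - Int.negOnePow (s - 1) • (w * X.d y) := by
      rw [X.leibniz hw.1, add_sub_cancel_right]
    rw [h1]
    refine Submodule.sub_mem _ (Submodule.mem_sup_right ⟨w * y, ?_, rfl⟩)
      (Submodule.mem_sup_left (negOnePow_smul_mem _ _ ?_))
    · have := X.mul_mem_Z hw hy'
      rwa [show s - 1 + s' = s + s' - 1 by ring,
        show M + r - 1 + M' = M + M' + r - 1 by ring] at this
    · have := X.mul_mem_Z hw hdy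
      rwa [show s - 1 + (s' + 1) = s + s' by ring,
        show M + r - 1 + (M' - r) = M + M' - 1 by ring] at this

theorem mul_mem_B_right {r s t M s' t' M' : ℤ} {x y : C} (hx : x ∈ X.Z r s t M)
    (hy : y ∈ X.B r s' t' M') : x * y ∈ X.B r (s + s') (t + t') (M + M') := by
  have hx' : x ∈ X.Z (r - 1) s t M := X.Z_le_Z le_rfl (by linarith) hx
  have hdx : X.d x ∈ X.Z (r - 1) (s + 1) t (M - r) :=
    X.Z_le_Z le_rfl (by linarith) (X.d_mem_Z hx)
  obtain ⟨u, hu, v, ⟨w, hw, rfl⟩, rfl⟩ := Submodule.mem_sup.1 hy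
  rw [mul_add]
  refine Submodule.add_mem _ (Submodule.mem_sup_left ?_) ?_
  · have := X.mul_mem_Z hx' hu
    rwa [show M + (M' - 1) = M + M' - 1 by ring] at this
  · have h1 : x * X.d w = Int.negOnePow s • (X.d (x * w) - X.d x * w) := by
      rw [X.leibniz hx.1, add_sub_cancel_left, smul_smul, Int.units_mul_self, one_smul]
    rw [h1]
    refine negOnePow_smul_mem _ _ (Submodule.sub_mem _
      (Submodule.mem_sup_right ⟨x * w, ?_, rfl⟩) (Submodule.mem_sup_left ?_))
    · have := X.mul_mem_Z hx' hw
      rwa [show s + (s' - 1) = s + s' - 1 by ring,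
        show M + (M' + r - 1) = M + M' + r - 1 by ring] at this
    · have := X.mul_mem_Z hdx hw
      rwa [show s + 1 + (s' - 1) = s + s' by ring,
        show M - r + (M' + r - 1) = M + M' - 1 by ring] at this

/-- Auxiliary to `mulE`. -/
noncomputable def mulZ (r : ℕ) (s t M s' t' M' : ℤ) :
    X.Z r s t M →ₗ[R] X.Z r s' t' M' →ₗ[R] X.E r (s + s') (t + t') (M + M') :=
  LinearMap.mk₂ R (fun x y => X.cls r _ _ _ (x * y : C) (X.mul_mem_Z x.2 y.2))
    (fun x x' y => by rw [cls, cls, cls, ← Submodule.Quotient.mk_add]; congr 1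
                      exact Subtype.ext (add_mul _ _ _))
    (fun c x y => by rw [cls, cls, ← Submodule.Quotient.mk_smul]; congr 1
                     exact Subtype.ext (smul_mul_assoc _ _ _))
    (fun x y y' => by rw [cls, cls, cls, ← Submodule.Quotient.mk_add]; congr 1
                      exact Subtype.ext (mul_add _ _ _))
    (fun c x y => by rw [cls, cls, ← Submodule.Quotient.mk_smul]; congr 1
                     exact Subtype.ext (mul_smul_comm _ _ _))

/-- The product of the spectral sequence, induced by the product of `C`. -/
noncomputable def mulE (r : ℕ) (s t M s' t' M' : ℤ) :
    X.E r s t M →ₗ[R] X.E r s' t' M' →ₗ[R] X.E r (s + s') (t + t') (M + M') :=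
  (Submodule.liftQ _ (Submodule.liftQ _ (X.mulZ r s t M s' t' M') (fun x hx => by
    ext y
    exact (Submodule.Quotient.mk_eq_zero _).2 (X.mul_mem_B_left hx y.2))).flip (fun y hy => by
    ext x
    exact (Submodule.Quotient.mk_eq_zero _).2 (X.mul_mem_B_right x.2 hy))).flip

/-- `y ∈ E_{r+1}` is the class of `x ∈ E_r`: the relation whose graph is the identification of
`E_{r+1}` with the homology of `(E_r, d_r)`. -/
def Survives {r : ℕ} {s t M : ℤ} (x : X.E r s t M) (y : X.E (r + 1) s t M) : Prop :=
  ∃ (z : C) (h : z ∈ X.Z r s t M) (h' : z ∈ X.Z (r + 1 : ℕ) s t M),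
    X.cls r s t M z h = x ∧ X.cls (r + 1) s t M z h' = y

/-- `x ∈ E_r` is an infinite (permanent) cycle: `d_r x = 0`, the class of `x` in `E_{r+1}` is a
`d_{r+1}`-cycle, and so on for all later pages. -/
def IsPermanentCycle {r : ℕ} {s t M : ℤ} (x : X.E r s t M) : Prop :=
  ∃ y : ∀ m : ℕ, X.E (r + m) s t M, y 0 = x ∧
    ∀ m, X.dE (r + m) s t M (y m) = 0 ∧ X.Survives (y m) (y (m + 1))

end FilteredDGA

end SpectralSequence

section MayFiltration

variable {R A : Type*} [CommRing R] [CommRing A] [Bialgebra R A] {I : Type*}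

/-- The subspace of `A` of inner degree `t` (modulo `N`) and filtration `≤ M`, spanned by the basis
elements `mono e` of inner degree `deg e ≡ t` and filtration `wt e ≤ M`. -/
def hopfFiltration (R : Type*) {A : Type*} [CommRing R] [CommRing A] [Bialgebra R A] {I : Type*}
    (mono : I → A) (deg wt : I → ℤ) (N t M : ℤ) : Submodule R A :=
  Submodule.span R {x | ∃ e : I, deg e ≡ t [ZMOD N] ∧ wt e ≤ M ∧ x = mono e}

/-- The subspace of the cobar construction of homological degree `s`, inner degree `t` (modulo `N`)
and filtration `≤ M`: the span of the `[a_1|...|a_s]` with basis elements `a_i` of total inner degree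
`≡ t` and total filtration `≤ M`.  (The basis element `1` contributes `[1] = 0`.) -/
def cobarFiltration (R : Type*) {A : Type*} [CommRing R] [CommRing A] [Bialgebra R A] {I : Type*}
    (mono : I → A) (deg wt : I → ℤ) (N s t M : ℤ) : Submodule R (Cobar R A) :=
  Submodule.span R {x | ∃ w : List I, (w.length : ℤ) = s ∧ (w.map deg).sum ≡ t [ZMOD N] ∧
    (w.map wt).sum ≤ M ∧ x = (w.map fun e => bar R (mono e)).prod}

/-- The cobar construction with the filtration induced from a filtration of the basis `mono`. -/
noncomputable def cobarDGA (R : Type*) {A : Type*} [CommRing R] [CommRing A] [Bialgebra R A]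
    {I : Type*} (mono : I → A) (deg wt : I → ℤ) (N : ℤ) : FilteredDGA R (Cobar R A) where
  d := cobarD R A
  d_d := cobarD_cobarD
  F := cobarFiltration R mono deg wt N
  F_mono := by
    intro s t M M' h
    apply Submodule.span_mono
    rintro x ⟨w, h1, h2, h3, h4⟩
    exact ⟨w, h1, h2, h3.trans h, h4⟩
  F_mul := by
    intro s t M s' t' M' x y hx hy
    have h := Submodule.mul_mem_mul hx hy
    rw [cobarFiltration, cobarFiltration, Submodule.span_mul_span] at h
    refine Submodule.span_mono ?_ h
    rintro _ ⟨_, ⟨w, h1, h2, h3, rfl⟩, _, ⟨w', h1', h2', h3', rfl⟩, rfl⟩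
    refine ⟨w ++ w', by simp [← h1, ← h1'], ?_, ?_, by simp⟩
    · rw [List.map_append, List.sum_append]; exact h2.add h2'
    · rw [List.map_append, List.sum_append]; exact add_le_add h3 h3'
  leibniz := by
    intro s t M x hx y
    rw [cobarD_mul]
    have : cobarSign R A x = Int.negOnePow s • x := by
      induction hx using Submodule.span_induction with
      | mem x hx =>
        obtain ⟨w, rfl, -, -, rfl⟩ := hx
        induction w with
        | nil => simp
        | cons e w ih =>
          simp only [List.map_cons, List.prod_cons, map_mul, cobarSign_bar, ih, List.length_cons]
          push_cast
          rw [Int.negOnePow_succ, Units.neg_smul, mul_smul_comm, neg_mul, smul_neg]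
      | zero => simp
      | add x y _ _ hx hy => rw [map_add, hx, hy, smul_add]
      | smul c x _ hx => rw [map_smul, hx, smul_comm]
    rw [this, smul_mul_assoc]

end MayFiltration

section MayST

variable (p n k : ℕ)

/-- `|t_s| = |ξ_s| = 2(p-1)(1 + p + ... + p^{s-1}) = 2(p^s - 1)`. -/
def genDegree (s : ℕ) : ℤ := 2 * ((p : ℤ) ^ s - 1)

/-- `∑_j m_j f(j)` for the `p`-adic expansion `m = ∑_j m_j p^j` (all digits with `j ≥ m` vanish). -/
def digitWeight (f : ℕ → ℤ) (m : ℕ) : ℤ := ∑ j ∈ range m, ((m / p ^ j % p : ℕ) : ℤ) * f j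

/-- The filtration of `t_s^{p^j}`: it is `2s-1` for `k ≤ s ≤ n+k-1`, and the maximum of `2s-1` and
`p` times the filtration of `t_{s-n}^{p^{j+n-1}}` plus one for `s ≥ n+k`. -/
def mayGen [NeZero n] (s j : ℕ) : ℤ :=
  if s < n + k then 2 * s - 1 else max (2 * (s : ℤ) - 1) (p * mayGen (s - n) (j + n - 1) + 1)
  termination_by s
  decreasing_by
    have := NeZero.ne n
    omega

/-- Exponents of the monomial basis of `S(n,k)`. -/
abbrev ExpS : Type := {e : {s : ℕ // k ≤ s} →₀ ℕ // ∀ s, e s < p ^ n}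

/-- Exponents of the monomial basis of `T(n,k)`. -/
abbrev ExpT : Type := {i : ℕ // k ≤ i ∧ i < n + k} →₀ ℕ

/-- The monomial `∏ t_s^{e_s}`. -/
noncomputable def monoS (e : ExpS p n k) : MoravaS p n k := e.1.prod fun s m => tElt p n k s ^ m
/-- Its inner degree, to be read modulo `2(p^n - 1)`. -/
def degS (e : ExpS p n k) : ℤ := e.1.sum fun s m => m * genDegree p s
/-- Its May filtration. -/
def wtS [NeZero n] (e : ExpS p n k) : ℤ := e.1.sum fun s m => digitWeight p (mayGen p n k s) m

/-- The monomial `∏ ξ_i^{e_i}`. -/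
noncomputable def monoT (e : ExpT n k) : MoravaT p n k := e.prod fun i m => xiElt p n k i ^ m
/-- Its inner degree. -/
def degT (e : ExpT n k) : ℤ := e.sum fun i m => m * genDegree p i
/-- Its May filtration; the filtration of `ξ_i^{p^j}` is `2i-1`. -/
def wtT (e : ExpT n k) : ℤ := e.sum fun i m => digitWeight p (fun _ => 2 * (i : ℤ) - 1) m

variable [Fact p.Prime] [NeZero n] [NeZero k]

/-- The part `F^{t,M} T(n,k)` of inner degree `t` and May filtration `≤ M`. -/
noncomputable def filtT (t M : ℤ) : Submodule (ZMod p) (MoravaT p n k) :=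
  hopfFiltration (ZMod p) (monoT p n k) (degT p n k) (wtT p n k) 0 t M

/-- The part `F^{t,M} S(n,k)` of inner degree `t` modulo `2(p^n-1)` and May filtration `≤ M`. -/
noncomputable def filtS (t M : ℤ) : Submodule (ZMod p) (MoravaS p n k) :=
  hopfFiltration (ZMod p) (monoS p n k) (degS p n k) (wtS p n k) (2 * ((p : ℤ) ^ n - 1)) t M

/-- The May filtered cobar complex of `T(n,k)`. -/
noncomputable def mayT : FilteredDGA (ZMod p) (Cobar (ZMod p) (MoravaT p n k)) :=
  cobarDGA (ZMod p) (monoT p n k) (degT p n k) (wtT p n k) 0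

/-- The May filtered cobar complex of `S(n,k)`. -/
noncomputable def mayS : FilteredDGA (ZMod p) (Cobar (ZMod p) (MoravaS p n k)) :=
  cobarDGA (ZMod p) (monoS p n k) (degS p n k) (wtS p n k) (2 * ((p : ℤ) ^ n - 1))

end MayST

section Reps
variable {A : Type*} [CommRing A] (p : ℕ) [Bialgebra (ZMod p) A]
/-- The cobar element `[a^{p^j}]`, representing `h_{i,j}` for `a = t_i` and `h'_{i,j}` for `a = ξ_i`. -/
noncomputable def hRep (a : A) (j : ℕ) : Cobar (ZMod p) A := bar (ZMod p) (a ^ p ^ j)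

/-- The cobar element `∑_{0<m<p} (1/p) (p choose m) [a^{m p^j}|a^{(p-m) p^j}]`, representing
`b_{i,j}` for `a = t_i` and `b'_{i,j}` for `a = ξ_i`. -/
noncomputable def bRep (a : A) (j : ℕ) : Cobar (ZMod p) A :=
  ∑ m ∈ Ioo 0 p, (p.choose m / p) •
    (bar (ZMod p) (a ^ (m * p ^ j)) * bar (ZMod p) (a ^ ((p - m) * p ^ j)))
end Reps

end MaySS

/-!
The reduction map sends `∏ ξ_i^{e_i}` to `∏ t_i^{e_i}`, and `t^{p^n} = t` allows one to lower the
exponents below `q = p^n` by means of `q a + b ↦ a + b`.  This keeps the inner degree modulo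
`2(p^n-1)`, and it does not raise the sum of the `p`-adic digits, which is subadditive.  Since
`t_i^{p^j}` has filtration `2i-1` for `k ≤ i ≤ n+k-1`, the same as `ξ_i^{p^j}`, basis monomials go
to basis monomials of no larger May filtration (`exists_reductionMap_monoT`).  A map of bialgebras
induces a cochain map of cobar constructions (`cobarMap_cobarD`); so the reduction map induces a
morphism of filtered differential algebras (`mayHom`), and every such morphism induces a
multiplicative map of spectral sequences (`FilteredDGA.Hom.mapE`), which preserves permanent cycles.

It remains to see that the representatives of `h'_{i,j}` and `b'_{i,j}` lie in `Z_1`, that is, that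
their coboundaries have lower filtration; the corresponding fact in `S(n,k)` then follows by
applying the cochain map, because `t_i^{p^j}` depends on `j` modulo `n` only.  For `x = ξ_i^{p^j}`
the coproduct is `x ⊗ 1 + 1 ⊗ x` up to filtration `2i-2` (`comul_xiElt_pow`), and hence that of `x^m`
is `(x ⊗ 1 + 1 ⊗ x)^m` up to filtration `m(2i-1)-1`.  The contributions of `(x ⊗ 1 + 1 ⊗ x)^m` to the
coboundary of `∑ (1/p) (p choose m) [x^m|x^{p-m}]` cancel (`transpotence_cancel`).
-/

namespace MaySS

open Finset
open scoped TensorProduct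

/-! ### Functoriality of the cobar construction -/

section CobarMap

variable {R A B : Type*} [CommRing R] [CommRing A] [Bialgebra R A] [CommRing B] [Bialgebra R B]

theorem cobarMap_bar (f : A →ₐc[R] B) (a : A) : cobarMap f (bar R a) = bar R (f a) := by
  rw [bar, LinearMap.comp_apply, cobarMap, TensorAlgebra.lift_ι_apply, bar, LinearMap.comp_apply,
    LinearMap.comp_apply]
  congr 1
  apply Subtype.ext
  have h : f (algebraMap R A (Coalgebra.counit a)) = algebraMap R B (Coalgebra.counit (f a)) := by
    rw [CoalgHomClass.counit_comp_apply]
    exact AlgHomClass.commutes f _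
  simp [augProj, h]

theorem cobarMap_sign (f : A →ₐc[R] B) (x : Cobar R A) :
    cobarMap f (cobarSign R A x) = cobarSign R B (cobarMap f x) := by
  have : (cobarMap f).comp (cobarSign R A) = (cobarSign R B).comp (cobarMap f) := by
    apply TensorAlgebra.hom_ext
    ext v
    simp [cobarSign, cobarMap]
  exact DFunLike.congr_fun this x

theorem cobarMap_redComul (f : A →ₐc[R] B) (a : A) :
    cobarMap f (redComul R A a) = redComul R B (f a) := by
  have h : (cobarMap f).toLinearMap.comp
      ((LinearMap.mul' R (Cobar R A)).comp (TensorProduct.map (bar R) (bar R))) =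
      ((LinearMap.mul' R (Cobar R B)).comp (TensorProduct.map (bar R) (bar R))).comp
        (TensorProduct.map (f : A →ₗ[R] B) (f : A →ₗ[R] B)) := by
    apply TensorProduct.ext'
    intro x y
    simp [cobarMap_bar]
  refine (LinearMap.congr_fun h (Coalgebra.comul a)).trans ?_
  rw [LinearMap.comp_apply, CoalgHomClass.map_comp_comul_apply]
  rfl

/-- A map of bialgebras induces a cochain map of cobar constructions. -/
theorem cobarMap_cobarD (f : A →ₐc[R] B) (x : Cobar R A) :
    cobarMap f (cobarD R A x) = cobarD R B (cobarMap f x) := by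
  induction x using TensorAlgebra.induction with
  | algebraMap r => rw [AlgHom.commutes, cobarD_algebraMap, cobarD_algebraMap, map_zero]
  | ι v =>
    have hv : TensorAlgebra.ι R v = bar R (v : A) := by
      rw [bar, LinearMap.comp_apply]
      congr 1
      apply Subtype.ext
      simp [augProj, LinearMap.mem_ker.1 v.2]
    rw [hv, cobarD_bar, map_neg, cobarMap_redComul, cobarMap_bar, cobarD_bar]
  | mul x y hx hy => simp only [cobarD_mul, map_add, map_mul, hx, hy, cobarMap_sign]
  | add x y hx hy => simp only [map_add, hx, hy]

end CobarMap

/-! ### Morphisms of filtered differential algebras and their spectral sequences -/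

namespace FilteredDGA

variable {R C C' : Type*} [CommRing R] [Ring C] [Algebra R C] [Ring C'] [Algebra R C']

/-- A morphism of filtered differential algebras: an algebra map which commutes with the
differentials and preserves homological degree, inner degree and filtration. -/
structure Hom (X : FilteredDGA R C) (Y : FilteredDGA R C') where
  /-- The underlying map of algebras. -/
  toAlgHom : C →ₐ[R] C'
  map_d : ∀ z, toAlgHom (X.d z) = Y.d (toAlgHom z)
  map_F : ∀ {s t M : ℤ} {z : C}, z ∈ X.F s t M → toAlgHom z ∈ Y.F s t M

namespace Hom

variable {X : FilteredDGA R C} {Y : FilteredDGA R C'} (f : Hom X Y)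

theorem map_Z {r s t M : ℤ} {z : C} (hz : z ∈ X.Z r s t M) : f.toAlgHom z ∈ Y.Z r s t M :=
  ⟨f.map_F hz.1, by
    change Y.d (f.toAlgHom z) ∈ Y.F (s + 1) t (M - r)
    rw [← f.map_d]
    exact f.map_F hz.2⟩

theorem map_B {r s t M : ℤ} {z : C} (hz : z ∈ X.B r s t M) : f.toAlgHom z ∈ Y.B r s t M := by
  obtain ⟨x, hx, _, ⟨w, hw, rfl⟩, rfl⟩ := Submodule.mem_sup.1 hz
  rw [map_add, f.map_d]
  exact Submodule.add_mem _ (Submodule.mem_sup_left (f.map_Z hx))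
    (Submodule.mem_sup_right ⟨_, f.map_Z hw, rfl⟩)

/-- The map of `E_r`-pages induced by a morphism of filtered differential algebras. -/
noncomputable def mapE (r : ℕ) (s t M : ℤ) : X.E r s t M →ₗ[R] Y.E r s t M :=
  Submodule.mapQ _ _ (f.toAlgHom.toLinearMap.restrict fun _ hz => f.map_Z hz)
    fun _ hz => f.map_B hz

theorem mapE_cls (r : ℕ) (s t M : ℤ) (z : C) (hz : z ∈ X.Z r s t M) :
    f.mapE r s t M (X.cls r s t M z hz) = Y.cls r s t M (f.toAlgHom z) (f.map_Z hz) := rfl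

theorem mapE_dE (r : ℕ) (s t M : ℤ) (x : X.E r s t M) :
    f.mapE r (s + 1) t (M - r) (X.dE r s t M x) = Y.dE r s t M (f.mapE r s t M x) := by
  obtain ⟨z, rfl⟩ := Submodule.Quotient.mk_surjective _ x
  refine congrArg Submodule.Quotient.mk (Subtype.ext ?_)
  exact f.map_d z

theorem mapE_survives {r : ℕ} {s t M : ℤ} {x : X.E r s t M} {y : X.E (r + 1) s t M}
    (h : X.Survives x y) : Y.Survives (f.mapE r s t M x) (f.mapE (r + 1) s t M y) := by
  obtain ⟨z, hz, hz', rfl, rfl⟩ := h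
  exact ⟨f.toAlgHom z, f.map_Z hz, f.map_Z hz', rfl, rfl⟩

theorem mapE_mulE (r : ℕ) (s t M s' t' M' : ℤ) (x : X.E r s t M) (y : X.E r s' t' M') :
    f.mapE r (s + s') (t + t') (M + M') (X.mulE r s t M s' t' M' x y) =
      Y.mulE r s t M s' t' M' (f.mapE r s t M x) (f.mapE r s' t' M' y) := by
  obtain ⟨z, rfl⟩ := Submodule.Quotient.mk_surjective _ x
  obtain ⟨w, rfl⟩ := Submodule.Quotient.mk_surjective _ y
  refine congrArg Submodule.Quotient.mk (Subtype.ext ?_)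
  exact map_mul f.toAlgHom (z : C) (w : C)

theorem mapE_isPermanentCycle {r : ℕ} {s t M : ℤ} {x : X.E r s t M} (h : X.IsPermanentCycle x) :
    Y.IsPermanentCycle (f.mapE r s t M x) := by
  obtain ⟨y, rfl, hy⟩ := h
  refine ⟨fun m => f.mapE (r + m) s t M (y m), rfl, fun m => ⟨?_, f.mapE_survives (hy m).2⟩⟩
  rw [← f.mapE_dE, (hy m).1, map_zero]

end Hom

end FilteredDGA

/-! ### The transpotence cocycle of an element which is primitive up to lower filtration -/

section Transpotence

variable (R : Type*) {A : Type*} [CommRing R] [CommRing A] [Bialgebra R A]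

/-- The linear map `a ⊗ b ↦ [a|b]`. -/
noncomputable def barPair : A ⊗[R] A →ₗ[R] Cobar R A :=
  (LinearMap.mul' R (Cobar R A)).comp (TensorProduct.map (bar R) (bar R))

@[simp]
theorem barPair_tmul (a b : A) : barPair R (a ⊗ₜ[R] b) = bar R a * bar R b := by
  simp [barPair]

theorem barPair_comul (a : A) : barPair R (Coalgebra.comul a) = redComul R A a := rfl

theorem barPair_primitive_pow (x : A) (m : ℕ) :
    barPair R ((x ⊗ₜ[R] (1 : A) + (1 : A) ⊗ₜ[R] x) ^ m) =
      ∑ y ∈ antidiagonal m, m.choose y.1 • (bar R (x ^ y.1) * bar R (x ^ y.2)) := by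
  rw [(Commute.all _ _).add_pow', map_sum]
  refine Finset.sum_congr rfl fun y _ => ?_
  rw [map_nsmul, Algebra.TensorProduct.tmul_pow, Algebra.TensorProduct.tmul_pow,
    Algebra.TensorProduct.tmul_mul_tmul, one_pow, one_pow, one_mul, mul_one, barPair_tmul]

theorem choose_div_mul_choose (p : ℕ) (hp : p.Prime) {a b c : ℕ} (ha : a ≠ 0) (hc : c ≠ 0)
    (h : a + b + c = p) :
    p.choose (a + b) / p * (a + b).choose a = p.choose a / p * (b + c).choose b := by
  have h1 : p ∣ p.choose (a + b) := hp.dvd_choose_self (by omega) (by omega)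
  have h2 : p ∣ p.choose a := hp.dvd_choose_self ha (by omega)
  apply Nat.eq_of_mul_eq_mul_left hp.pos
  rw [← mul_assoc, ← mul_assoc, Nat.mul_div_cancel' h1, Nat.mul_div_cancel' h2,
    Nat.choose_mul (Nat.le_add_right a b)]
  congr 2 <;> omega

/-- If `x` were primitive, `∑_{0<m<p} (1/p) (p choose m) [x^m|x^{p-m}]` would be a cocycle: the
coefficient of `[x^a|x^b|x^c]` in its coboundary is a difference of two expressions for
`(p-1)! / (a! b! c!)`. -/
theorem transpotence_cancel (p : ℕ) (hp : p.Prime) (x : A) :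
    ∑ m ∈ Ioo 0 p, (p.choose m / p) •
      (barPair R ((x ⊗ₜ[R] (1 : A) + (1 : A) ⊗ₜ[R] x) ^ m) * bar R (x ^ (p - m)) -
        bar R (x ^ m) * barPair R ((x ⊗ₜ[R] (1 : A) + (1 : A) ⊗ₜ[R] x) ^ (p - m))) = 0 := by
  -- The extreme terms may be added: their coefficient `1 / p` is `0` in `ℕ`.
  have hext : ∀ g : ℕ → ℕ → Cobar R A, ∑ m ∈ Ioo 0 p, (p.choose m / p) • g m (p - m) =
      ∑ y ∈ antidiagonal p, (p.choose y.1 / p) • g y.1 y.2 := by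
    intro g
    rw [Finset.Nat.sum_antidiagonal_eq_sum_range_succ
      (fun i j => (p.choose i / p) • g i j)]
    refine Finset.sum_subset (fun m hm => ?_) fun m hm hm' => ?_
    · simp only [mem_Ioo, mem_range] at hm ⊢; omega
    · have : m = 0 ∨ m = p := by simp only [mem_Ioo, mem_range] at hm hm'; omega
      rcases this with rfl | rfl <;> simp [Nat.div_eq_of_lt hp.one_lt]
  rw [hext (fun m l => barPair R ((x ⊗ₜ[R] (1 : A) + (1 : A) ⊗ₜ[R] x) ^ m) * bar R (x ^ l) -
    bar R (x ^ m) * barPair R ((x ⊗ₜ[R] (1 : A) + (1 : A) ⊗ₜ[R] x) ^ l))]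
  simp only [smul_sub, Finset.sum_sub_distrib, barPair_primitive_pow, Finset.sum_mul,
    Finset.mul_sum, Finset.smul_sum]
  rw [sub_eq_zero, Finset.sum_sigma', Finset.sum_sigma']
  refine Finset.sum_nbij' (fun x => ⟨(x.2.1, x.2.2 + x.1.2), (x.2.2, x.1.2)⟩)
    (fun x => ⟨(x.1.1 + x.2.1, x.2.2), (x.1.1, x.2.1)⟩) ?_ ?_ ?_ ?_ ?_
  · rintro ⟨⟨a, b⟩, ⟨c, d⟩⟩ h; simp at h ⊢; omega
  · rintro ⟨⟨a, b⟩, ⟨c, d⟩⟩ h; simp at h ⊢; omega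
  · rintro ⟨⟨a, b⟩, ⟨c, d⟩⟩ h; simp at h ⊢; obtain ⟨h, rfl⟩ := h; simp
  · rintro ⟨⟨a, b⟩, ⟨c, d⟩⟩ h; simp at h ⊢; obtain ⟨h, rfl⟩ := h; simp
  · rintro ⟨⟨m, c⟩, ⟨a, b⟩⟩ h
    simp only [mem_sigma, HasAntidiagonal.mem_antidiagonal] at h ⊢
    obtain ⟨h, rfl⟩ := h
    rcases eq_or_ne a 0 with rfl | ha
    · simp [bar_one]
    rcases eq_or_ne c 0 with rfl | hc
    · simp [bar_one]
    rw [smul_mul_assoc, mul_smul_comm, smul_smul, smul_smul, mul_assoc,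
      choose_div_mul_choose p hp ha hc h]

theorem cobarD_transpotence (p : ℕ) (hp : p.Prime) (x : A) :
    cobarD R A (∑ m ∈ Ioo 0 p, (p.choose m / p) • (bar R (x ^ m) * bar R (x ^ (p - m)))) =
      ∑ m ∈ Ioo 0 p, (p.choose m / p) •
        (bar R (x ^ m) * barPair R (Coalgebra.comul (x ^ (p - m)) -
            (x ⊗ₜ[R] (1 : A) + (1 : A) ⊗ₜ[R] x) ^ (p - m)) -
          barPair R (Coalgebra.comul (x ^ m) - (x ⊗ₜ[R] (1 : A) + (1 : A) ⊗ₜ[R] x) ^ m) *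
            bar R (x ^ (p - m))) := by
  rw [← add_zero (cobarD R A _), ← transpotence_cancel R p hp x, map_sum,
    ← Finset.sum_add_distrib]
  refine Finset.sum_congr rfl fun m _ => ?_
  rw [map_nsmul, ← smul_add, cobarD_mul, cobarD_bar, cobarD_bar, cobarSign_bar, map_sub, map_sub,
    barPair_comul, barPair_comul]
  congr 1
  noncomm_ring

end Transpotence

/-! ### Digit sums -/

section DigitSum

variable (p : ℕ)

theorem sum_digits_eq_mod_add [hp : Fact p.Prime] (m : ℕ) :
    (p.digits m).sum = m % p + (p.digits (m / p)).sum := by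
  rcases Nat.eq_zero_or_pos m with rfl | h
  · simp
  · rw [Nat.digits_def' hp.out.one_lt h, List.sum_cons]

theorem sum_digits_add_le [hp : Fact p.Prime] (a b : ℕ) :
    (p.digits (a + b)).sum ≤ (p.digits a).sum + (p.digits b).sum := by
  -- By Legendre's formula this is `v_p(a!) + v_p(b!) ≤ v_p((a + b)!)`.
  have h1 : padicValNat p a.factorial + padicValNat p b.factorial ≤
      padicValNat p (a + b).factorial := by
    rw [← padicValNat.mul a.factorial_ne_zero b.factorial_ne_zero]
    exact (padicValNat_dvd_iff_le (a + b).factorial_ne_zero).1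
      (pow_padicValNat_dvd.trans (Nat.factorial_mul_factorial_dvd_factorial_add a b))
  have h2 := Nat.mul_le_mul_left (p - 1) h1
  rw [mul_add, sub_one_mul_padicValNat_factorial, sub_one_mul_padicValNat_factorial,
    sub_one_mul_padicValNat_factorial] at h2
  have ha := Nat.digit_sum_le p a
  have hb := Nat.digit_sum_le p b
  have hab := Nat.digit_sum_le p (a + b)
  omega

theorem sum_digits_pow_mul_add [hp : Fact p.Prime] (n a r : ℕ) (hr : r < p ^ n) :
    (p.digits (p ^ n * a + r)).sum = (p.digits a).sum + (p.digits r).sum := by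
  induction n generalizing r with
  | zero => obtain rfl : r = 0 := by simpa using hr
            simp
  | succ n ih =>
    have hp0 := hp.out.pos
    rw [sum_digits_eq_mod_add p (_ + r), sum_digits_eq_mod_add p r,
      show p ^ (n + 1) * a + r = r + p * (p ^ n * a) by ring, Nat.add_mul_mod_self_left,
      Nat.add_mul_div_left _ _ hp0, add_comm (r / p),
      ih _ (Nat.div_lt_of_lt_mul (by rwa [pow_succ'] at hr))]
    ring

theorem sum_digits_mul_pow [hp : Fact p.Prime] {m : ℕ} (hm : m ≤ p) (h : m ≠ p) (j : ℕ) :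
    (p.digits (m * p ^ j)).sum = m := by
  have := sum_digits_pow_mul_add p j m 0 (pow_pos hp.out.pos j)
  rw [add_zero, mul_comm] at this
  rw [this]
  rcases Nat.eq_zero_or_pos m with rfl | h0
  · simp
  · simp [Nat.digits_of_lt p m h0.ne' (by omega)]

theorem digitWeight_const [hp : Fact p.Prime] (c : ℤ) (m : ℕ) :
    digitWeight p (fun _ => c) m = (p.digits m).sum * c := by
  induction m using Nat.strong_induction_on with
  | _ m ih =>
    rcases m with _ | m
    · simp [digitWeight]
    have hlt : (m + 1) / p < m + 1 := Nat.div_lt_self (Nat.succ_pos m) hp.out.one_lt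
    rw [sum_digits_eq_mod_add, Nat.cast_add, add_mul, ← ih _ hlt, digitWeight,
      Finset.sum_range_succ', add_comm, digitWeight]
    simp only [pow_zero, Nat.div_one]
    congr 1
    simp only [pow_succ', ← Nat.div_div_eq_div_mul]
    symm
    refine Finset.sum_subset (Finset.range_mono (by omega)) fun j _ hj => ?_
    have : (m + 1) / p < p ^ j :=
      lt_of_le_of_lt (by simpa using hj) (Nat.lt_pow_self hp.out.one_lt)
    simp [Nat.div_eq_of_lt this]

/-- The exponents of a monomial can be lowered below `q = p ^ n` by means of `x ^ q = x`, that is by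
`e = q a + b ↦ a + b`.  This does not increase the sum of the `p`-adic digits. -/
theorem exists_reduced_exponent [hp : Fact p.Prime] (n : ℕ) [NeZero n] (e : ℕ) :
    ∃ e' < p ^ n, (e = 0 → e' = 0) ∧ (e' : ℤ) ≡ e [ZMOD (p : ℤ) ^ n - 1] ∧
      (p.digits e').sum ≤ (p.digits e).sum ∧
      ∀ {A : Type} [Monoid A] (x : A), x ^ p ^ n = x → x ^ e' = x ^ e := by
  have hq : 1 < p ^ n := Nat.one_lt_pow (NeZero.ne n) hp.out.one_lt
  induction e using Nat.strong_induction_on with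
  | _ e ih =>
    rcases Nat.lt_or_ge e (p ^ n) with h | h
    · exact ⟨e, h, id, rfl, le_rfl, fun _ _ => rfl⟩
    · have hdm := Nat.div_add_mod e (p ^ n)
      have hmod := Nat.mod_lt e (by omega : 0 < p ^ n)
      have hpos : 0 < e / p ^ n := Nat.div_pos h (by omega)
      set a := e / p ^ n
      set b := e % p ^ n
      obtain ⟨e', h1, -, h2, h3, h4⟩ := ih (a + b) (by nlinarith)
      refine ⟨e', h1, by omega, h2.trans ?_, h3.trans ((sum_digits_add_le p a b).trans ?_), ?_⟩
      · rw [← hdm]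
        refine Int.modEq_iff_dvd.2 ⟨a, ?_⟩
        push_cast
        ring
      · rw [← hdm, sum_digits_pow_mul_add p n a b hmod]
      · intro A _ x hx
        rw [h4 x hx, ← hdm, pow_add, pow_add, pow_mul, hx]

end DigitSum

section Monomials

variable (p n k : ℕ)

/-! ### The reduction map on monomials -/

theorem mayGen_of_lt [NeZero n] {s : ℕ} (hs : s < n + k) (j : ℕ) :
    mayGen p n k s j = 2 * s - 1 := by
  rw [mayGen, if_pos hs]

variable [hp : Fact p.Prime]

theorem wtT_eq_sum_digits (e : ExpT n k) :
    wtT p n k e = e.sum fun i m => (p.digits m).sum * (2 * (i : ℤ) - 1) :=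
  Finset.sum_congr rfl fun _ _ => digitWeight_const p _ _

variable [NeZero n] [NeZero k]

theorem reductionMap_xiElt {i : ℕ} (hi : i < n + k) :
    reductionMap p n k (xiElt p n k i) = tElt p n k i :=
  MoravaT.lift_xiElt _ tElt_zero (fun _ h0 h => tElt_of_lt h0 h) i hi

/-- The reduction map sends a basis monomial to a basis monomial of the same inner degree modulo
`2(p^n-1)` and of no larger May filtration. -/
theorem exists_reductionMap_monoT (e : ExpT n k) : ∃ e' : ExpS p n k,
    reductionMap p n k (monoT p n k e) = monoS p n k e' ∧
    degS p n k e' ≡ degT p n k e [ZMOD 2 * ((p : ℤ) ^ n - 1)] ∧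
    wtS p n k e' ≤ wtT p n k e := by
  choose red hlt hzero hmod hsum hpow using exists_reduced_exponent p n
  let ι : {i : ℕ // k ≤ i ∧ i < n + k} ↪ {s : ℕ // k ≤ s} :=
    ⟨fun i => ⟨i.1, i.2.1⟩, fun i j h => Subtype.ext (Subtype.mk.inj h)⟩
  let r : ExpT n k := e.mapRange red (hzero 0 rfl)
  have hr : ∀ s, r.embDomain ι s < p ^ n := by
    intro s
    by_cases hs : s ∈ Set.range ι
    · obtain ⟨i, rfl⟩ := hs
      rw [Finsupp.embDomain_apply_self, Finsupp.mapRange_apply]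
      exact hlt _
    · rw [Finsupp.embDomain_of_notMem_range _ _ _ hs]
      exact pow_pos hp.out.pos n
  refine ⟨⟨r.embDomain ι, hr⟩, ?_, ?_, ?_⟩
  · rw [monoS, Finsupp.prod_embDomain, Finsupp.prod_mapRange_index (by simp), monoT, Finsupp.prod,
      Finsupp.prod, map_prod]
    refine Finset.prod_congr rfl fun i _ => ?_
    rw [map_pow, reductionMap_xiElt p n k i.2.2]
    exact (hpow _ _ (MoravaS.pow_eq _)).symm
  · rw [degS, Finsupp.sum_embDomain, Finsupp.sum_mapRange_index (by simp), degT]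
    refine Int.ModEq.sum fun i _ => ?_
    have := ((hmod (e i)).mul_left' (c := 2)).mul_right ((p : ℤ) ^ i.1 - 1)
    have hi : (ι i : ℕ) = i := rfl
    simp only [genDegree, hi]
    convert this using 1 <;> ring
  · rw [wtS, Finsupp.sum_embDomain, Finsupp.sum_mapRange_index (by simp [digitWeight]),
      wtT_eq_sum_digits]
    refine Finset.sum_le_sum fun i _ => ?_
    have hi := i.2.1
    have hk := NeZero.ne k
    have hw : mayGen p n k (ι i) = fun _ => 2 * (i.1 : ℤ) - 1 :=
      funext (mayGen_of_lt p n k i.2.2)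
    change digitWeight p (mayGen p n k (ι i)) (red (e i)) ≤ _
    rw [hw, digitWeight_const]
    exact mul_le_mul_of_nonneg_right (by exact_mod_cast hsum _) (by omega)

theorem reductionMap_mem_filtS {t M : ℤ} {x : MoravaT p n k} (hx : x ∈ filtT p n k t M) :
    reductionMap p n k x ∈ filtS p n k t M := by
  induction hx using Submodule.span_induction with
  | mem x hx =>
    obtain ⟨e, h1, h2, rfl⟩ := hx
    obtain ⟨e', he, hd, hw⟩ := exists_reductionMap_monoT p n k e
    rw [he]
    exact Submodule.subset_span ⟨e', hd.trans (h1.of_dvd (dvd_zero _)), hw.trans h2, rfl⟩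
  | zero => rw [map_zero]; exact Submodule.zero_mem _
  | add x y _ _ hx hy => rw [map_add]; exact Submodule.add_mem _ hx hy
  | smul c x _ hx => rw [map_smul]; exact Submodule.smul_mem _ c hx

theorem cobarMap_reductionMap_mem {s t M : ℤ} {z : Cobar (ZMod p) (MoravaT p n k)}
    (hz : z ∈ (mayT p n k).F s t M) :
    cobarMap (reductionMap p n k) z ∈ (mayS p n k).F s t M := by
  choose red hmono hdeg hwt using exists_reductionMap_monoT p n k
  induction hz using Submodule.span_induction with
  | mem z hz =>
    obtain ⟨w, h1, h2, h3, rfl⟩ := hz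
    refine Submodule.subset_span ⟨w.map red, by simpa using h1, ?_, ?_, ?_⟩
    · refine Int.ModEq.trans ?_ (h2.of_dvd (dvd_zero _))
      clear h1 h2 h3
      induction w with
      | nil => rfl
      | cons e w ih => simpa using (hdeg e).add ih
    · refine le_trans ?_ h3
      clear h1 h2 h3
      induction w with
      | nil => simp
      | cons e w ih => simpa using add_le_add (hwt e) ih
    · rw [map_list_prod, List.map_map, List.map_map]
      congr 2
      funext e
      simp [cobarMap_bar, hmono]
  | zero => rw [map_zero]; exact Submodule.zero_mem _
  | add x y _ _ hx hy => rw [map_add]; exact Submodule.add_mem _ hx hy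
  | smul c x _ hx => rw [map_smul]; exact Submodule.smul_mem _ c hx

/-- The map of May filtered cobar complexes induced by the reduction map. -/
noncomputable def mayHom : FilteredDGA.Hom (mayT p n k) (mayS p n k) where
  toAlgHom := cobarMap (reductionMap p n k)
  map_d := cobarMap_cobarD _
  map_F := cobarMap_reductionMap_mem p n k

end Monomials

section TensorFiltration

variable (p n k : ℕ)

/-! ### The May filtration of the tensor square of `T(n,k)` -/

theorem monoT_add (e f : ExpT n k) : monoT p n k (e + f) = monoT p n k e * monoT p n k f :=
  Finsupp.prod_add_index' (by simp) fun _ _ _ => pow_add _ _ _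

theorem degT_add (e f : ExpT n k) : degT p n k (e + f) = degT p n k e + degT p n k f :=
  Finsupp.sum_add_index' (by simp) fun _ _ _ => by push_cast; ring

theorem monoT_zero : monoT p n k 0 = 1 := Finsupp.prod_zero_index

theorem degT_zero : degT p n k 0 = 0 := Finsupp.sum_zero_index

theorem wtT_zero : wtT p n k 0 = 0 := Finsupp.sum_zero_index

variable [hp : Fact p.Prime]

theorem wtT_add_le [NeZero k] (e f : ExpT n k) :
    wtT p n k (e + f) ≤ wtT p n k e + wtT p n k f := by
  classical
  have h : ∀ g : ExpT n k, g.support ⊆ e.support ∪ f.support → wtT p n k g =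
      ∑ i ∈ e.support ∪ f.support, (p.digits (g i)).sum * (2 * (i : ℤ) - 1) := fun g hg => by
    rw [wtT_eq_sum_digits]
    exact Finsupp.sum_of_support_subset _ hg _ (by simp)
  rw [h _ Finsupp.support_add, h e subset_union_left, h f subset_union_right,
    ← Finset.sum_add_distrib]
  refine Finset.sum_le_sum fun i _ => ?_
  have hi := i.2.1
  have hk := NeZero.ne k
  rw [← add_mul]
  exact mul_le_mul_of_nonneg_right (by exact_mod_cast sum_digits_add_le p (e i) (f i)) (by omega)

/-- The span of the tensors `a ⊗ b` of basis monomials of `T(n,k)` of total inner degree `t` and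
total May filtration `≤ M`. -/
noncomputable def tensorFiltT (t M : ℤ) :
    Submodule (ZMod p) (MoravaT p n k ⊗[ZMod p] MoravaT p n k) :=
  Submodule.span (ZMod p) {x | ∃ e f : ExpT n k, degT p n k e + degT p n k f = t ∧
    wtT p n k e + wtT p n k f ≤ M ∧ x = monoT p n k e ⊗ₜ monoT p n k f}

variable {p n k}

theorem tensorFiltT_mono {t M M' : ℤ} (h : M ≤ M') : tensorFiltT p n k t M ≤ tensorFiltT p n k t M' :=
  Submodule.span_mono fun _ ⟨e, f, h1, h2, h3⟩ => ⟨e, f, h1, h2.trans h, h3⟩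

theorem mul_mem_tensorFiltT [NeZero k] {t M t' M' : ℤ}
    {x y : MoravaT p n k ⊗[ZMod p] MoravaT p n k} (hx : x ∈ tensorFiltT p n k t M)
    (hy : y ∈ tensorFiltT p n k t' M') : x * y ∈ tensorFiltT p n k (t + t') (M + M') := by
  have h := Submodule.mul_mem_mul hx hy
  rw [tensorFiltT, tensorFiltT, Submodule.span_mul_span] at h
  refine Submodule.span_mono ?_ h
  rintro _ ⟨_, ⟨e, f, h1, h2, rfl⟩, _, ⟨e', f', h1', h2', rfl⟩, rfl⟩
  refine ⟨e + e', f + f', ?_, ?_, ?_⟩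
  · rw [degT_add, degT_add]; omega
  · have := wtT_add_le p n k e e'
    have := wtT_add_le p n k f f'
    omega
  · simp only [Algebra.TensorProduct.tmul_mul_tmul, monoT_add]

theorem one_mem_tensorFiltT : 1 ∈ tensorFiltT p n k 0 0 :=
  Submodule.subset_span ⟨0, 0, by simp [degT_zero], by simp [wtT_zero],
    by simp [monoT_zero, Algebra.TensorProduct.one_def]⟩

theorem pow_mem_tensorFiltT [NeZero k] {t M : ℤ} {x : MoravaT p n k ⊗[ZMod p] MoravaT p n k}
    (hx : x ∈ tensorFiltT p n k t M) (m : ℕ) : x ^ m ∈ tensorFiltT p n k (m * t) (m * M) := by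
  induction m with
  | zero => simpa using one_mem_tensorFiltT
  | succ m ih =>
    have := mul_mem_tensorFiltT ih hx
    rw [pow_succ]
    convert this using 1
    push_cast
    congr 1 <;> ring

/-- Changing an element of filtration `M` in filtration `M - 1` changes its `m`-th power only in
filtration `m M - 1`. -/
theorem add_pow_sub_pow_mem_tensorFiltT [NeZero k] {t M : ℤ}
    {x y : MoravaT p n k ⊗[ZMod p] MoravaT p n k} (hx : x ∈ tensorFiltT p n k t M)
    (hy : y ∈ tensorFiltT p n k t (M - 1)) (m : ℕ) :
    (x + y) ^ m - x ^ m ∈ tensorFiltT p n k (m * t) (m * M - 1) := by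
  induction m with
  | zero => simp
  | succ m ih =>
    have h1 := mul_mem_tensorFiltT ih
      (Submodule.add_mem _ hx (tensorFiltT_mono (sub_one_lt M).le hy))
    have h2 := mul_mem_tensorFiltT (pow_mem_tensorFiltT hx m) hy
    rw [show (x + y) ^ (m + 1) - x ^ (m + 1) =
      ((x + y) ^ m - x ^ m) * (x + y) + x ^ m * y by ring]
    push_cast
    rw [show ((m : ℤ) + 1) * t = m * t + t by ring,
      show ((m : ℤ) + 1) * M - 1 = m * M - 1 + M by ring]
    exact Submodule.add_mem _ h1 (by rwa [show m * M - 1 + M = m * M + (M - 1) by ring])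

theorem exists_monoT_eq_xiElt_pow {i : ℕ} (hk : k ≤ i) (hi : i < n + k) {m : ℕ} (hm : m < p)
    (j : ℕ) : ∃ e : ExpT n k, monoT p n k e = xiElt p n k i ^ (m * p ^ j) ∧
      degT p n k e = m * p ^ j * genDegree p i ∧ wtT p n k e = m * (2 * i - 1) := by
  refine ⟨Finsupp.single ⟨i, hk, hi⟩ (m * p ^ j), ?_, ?_, ?_⟩
  · exact Finsupp.prod_single_index (pow_zero _)
  · rw [degT, Finsupp.sum_single_index (by simp)]
    push_cast
    rfl
  · rw [wtT_eq_sum_digits, Finsupp.sum_single_index (by simp),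
      sum_digits_mul_pow p hm.le hm.ne]

theorem exists_monoT_eq_xiElt_pow_prime_pow {i : ℕ} (hk : k ≤ i) (hi : i < n + k) (j : ℕ) :
    ∃ e : ExpT n k, monoT p n k e = xiElt p n k i ^ p ^ j ∧
      degT p n k e = p ^ j * genDegree p i ∧ wtT p n k e = 2 * i - 1 := by
  simpa using exists_monoT_eq_xiElt_pow (p := p) hk hi hp.out.one_lt j

variable [NeZero k]

theorem barPair_mem_mayT {t M : ℤ} {x : MoravaT p n k ⊗[ZMod p] MoravaT p n k}
    (hx : x ∈ tensorFiltT p n k t M) : barPair (ZMod p) x ∈ (mayT p n k).F 2 t M := by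
  induction hx using Submodule.span_induction with
  | mem x hx =>
    obtain ⟨e, f, h1, h2, rfl⟩ := hx
    exact Submodule.subset_span ⟨[e, f], rfl, by simp [h1], by simpa using h2, by simp⟩
  | zero => rw [map_zero]; exact Submodule.zero_mem _
  | add x y _ _ hx hy => rw [map_add]; exact Submodule.add_mem _ hx hy
  | smul c x _ hx => rw [map_smul]; exact Submodule.smul_mem _ c hx

/-! ### The cocycles representing `h'` and `b'` -/

theorem bar_xiElt_pow_mem {i : ℕ} (hk : k ≤ i) (hi : i < n + k) {m : ℕ} (hm : m < p) (j : ℕ) :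
    bar (ZMod p) ((xiElt p n k i ^ p ^ j) ^ m) ∈
      (mayT p n k).F 1 (m * (p ^ j * genDegree p i)) (m * (2 * i - 1)) := by
  obtain ⟨e, h1, h2, h3⟩ := exists_monoT_eq_xiElt_pow (p := p) hk hi hm j
  refine Submodule.subset_span ⟨[e], rfl, ?_, ?_, ?_⟩
  · simp [h2, mul_assoc]
  · simp [h3]
  · rw [← pow_mul, mul_comm, ← h1]; simp

/-- The leading part `x ⊗ 1 + 1 ⊗ x` of the coproduct of `x = ξ_i^{p^j}` has filtration `2i-1`, and
the remaining terms `ξ_a^{p^j} ⊗ ξ_b^{p^{a+j}}`, with `a + b = i` and `a, b > 0`, have filtration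
`(2a-1) + (2b-1) = 2i-2`. -/
theorem comul_xiElt_pow {i : ℕ} (hk : k ≤ i) (hi : i < n + k) (j : ℕ) :
    (xiElt p n k i ^ p ^ j) ⊗ₜ[ZMod p] (1 : MoravaT p n k) +
        (1 : MoravaT p n k) ⊗ₜ[ZMod p] (xiElt p n k i ^ p ^ j) ∈
      tensorFiltT p n k (p ^ j * genDegree p i) (2 * i - 1) ∧
    Coalgebra.comul (R := ZMod p) (xiElt p n k i ^ p ^ j) -
        ((xiElt p n k i ^ p ^ j) ⊗ₜ[ZMod p] (1 : MoravaT p n k) +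
          (1 : MoravaT p n k) ⊗ₜ[ZMod p] (xiElt p n k i ^ p ^ j)) ∈
      tensorFiltT p n k (p ^ j * genDegree p i) (2 * i - 1 - 1) := by
  have hk0 := NeZero.ne k
  constructor
  · obtain ⟨e, h1, h2, h3⟩ := exists_monoT_eq_xiElt_pow_prime_pow (p := p) hk hi j
    rw [← h1]
    refine Submodule.add_mem _ (Submodule.subset_span ⟨e, 0, ?_, ?_, ?_⟩)
      (Submodule.subset_span ⟨0, e, ?_, ?_, ?_⟩) <;> simp [h2, h3, degT_zero, wtT_zero, monoT_zero]
  · have hc : Coalgebra.comul (R := ZMod p) (xiElt p n k i ^ p ^ j) =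
        ∑ x ∈ antidiagonal i,
          (xiElt p n k x.1 ^ p ^ j) ⊗ₜ[ZMod p] (xiElt p n k x.2 ^ p ^ (x.1 + j)) := by
      rw [Bialgebra.comul_pow]
      refine (congrArg (· ^ p ^ j) (comulT_xiElt p n k i hi)).trans ?_
      simp only [comulGenT]
      rw [sum_pow_char_pow]
      refine Finset.sum_congr rfl fun x _ => ?_
      rw [Algebra.TensorProduct.tmul_pow, ← pow_mul, ← pow_add]
    have hne : ((0, i) : ℕ × ℕ) ∈ (antidiagonal i).erase (i, 0) := by
      simp only [mem_erase, HasAntidiagonal.mem_antidiagonal, ne_eq, Prod.mk.injEq]; omega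
    rw [hc, ← Finset.add_sum_erase _ _ (show ((i, 0) : ℕ × ℕ) ∈ antidiagonal i by simp),
      ← Finset.add_sum_erase _ _ hne]
    simp only [xiElt_zero, one_pow, zero_add]
    rw [← add_assoc, add_sub_cancel_left]
    refine Submodule.sum_mem _ fun x hx => ?_
    obtain ⟨a, b⟩ := x
    simp only [mem_erase, HasAntidiagonal.mem_antidiagonal, ne_eq, Prod.mk.injEq] at hx
    simp only
    have ha : 0 < a := by omega
    have hb : 0 < b := by omega
    rcases Nat.lt_or_ge a k with hak | hak
    · simp [xiElt_of_lt ha hak, hp.out.ne_zero]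
    rcases Nat.lt_or_ge b k with hbk | hbk
    · simp [xiElt_of_lt hb hbk, hp.out.ne_zero]
    obtain ⟨e, h1, h2, h3⟩ := exists_monoT_eq_xiElt_pow_prime_pow (p := p) (n := n) hak (by omega) j
    obtain ⟨f, h1', h2', h3'⟩ :=
      exists_monoT_eq_xiElt_pow_prime_pow (p := p) (n := n) hbk (by omega) (a + j)
    refine Submodule.subset_span ⟨e, f, ?_, by omega, by rw [h1, h1']⟩
    rw [h2, h2', ← hx.2.2, genDegree, genDegree, genDegree]
    ring

theorem comul_xiElt_pow_pow {i : ℕ} (hk : k ≤ i) (hi : i < n + k) (j m : ℕ) :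
    Coalgebra.comul (R := ZMod p) ((xiElt p n k i ^ p ^ j) ^ m) -
        ((xiElt p n k i ^ p ^ j) ⊗ₜ[ZMod p] (1 : MoravaT p n k) +
          (1 : MoravaT p n k) ⊗ₜ[ZMod p] (xiElt p n k i ^ p ^ j)) ^ m ∈
      tensorFiltT p n k (m * (p ^ j * genDegree p i)) (m * (2 * i - 1) - 1) := by
  obtain ⟨h1, h2⟩ := comul_xiElt_pow (p := p) hk hi j
  have := add_pow_sub_pow_mem_tensorFiltT h1 h2 m
  rwa [add_sub_cancel, ← Bialgebra.comul_pow] at this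

theorem hRep_xiElt_mem_Z {i : ℕ} (hk : k ≤ i) (hi : i < n + k) (j : ℕ) :
    hRep p (xiElt p n k i) j ∈
      (mayT p n k).Z (1 : ℕ) 1 (2 * (p ^ i - 1) * p ^ j) (2 * i - 1) := by
  have ht : (2 * ((p : ℤ) ^ i - 1) * p ^ j) = p ^ j * genDegree p i := by
    rw [genDegree]; ring
  rw [ht]
  refine ⟨by simpa [hRep] using bar_xiElt_pow_mem (p := p) hk hi hp.out.one_lt j, ?_⟩
  change cobarD (ZMod p) _ (bar (ZMod p) _) ∈ (mayT p n k).F 2 _ _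
  rw [cobarD_bar, ← barPair_comul]
  refine Submodule.neg_mem _ ?_
  have := barPair_mem_mayT (comul_xiElt_pow (p := p) hk hi j).2
  simpa [bar_one] using this

theorem bRep_eq {A : Type*} [CommRing A] [Bialgebra (ZMod p) A] (a : A) (j : ℕ) :
    bRep p a j = ∑ m ∈ Ioo 0 p, (p.choose m / p) •
      (bar (ZMod p) ((a ^ p ^ j) ^ m) * bar (ZMod p) ((a ^ p ^ j) ^ (p - m))) := by
  simp only [bRep, ← pow_mul, mul_comm]

theorem bRep_xiElt_mem_Z {i : ℕ} (hk : k ≤ i) (hi : i < n + k) (j : ℕ) :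
    bRep p (xiElt p n k i) j ∈
      (mayT p n k).Z (1 : ℕ) 2 (2 * (p ^ i - 1) * p ^ (j + 1)) (p * (2 * i - 1)) := by
  have ht : ∀ m ∈ Ioo 0 p, (2 * ((p : ℤ) ^ i - 1) * p ^ (j + 1)) =
      m * (p ^ j * genDegree p i) + (p - m : ℕ) * (p ^ j * genDegree p i) := fun m hm => by
    rw [Nat.cast_sub (mem_Ioo.1 hm).2.le, genDegree]; ring
  have hM : ∀ m ∈ Ioo 0 p, (p * (2 * i - 1) : ℤ) =
      m * (2 * i - 1) + (p - m : ℕ) * (2 * i - 1) := fun m hm => by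
    rw [Nat.cast_sub (mem_Ioo.1 hm).2.le]; ring
  have hF : ∀ m ∈ Ioo 0 p, p - m < p := fun m hm => by rw [mem_Ioo] at hm; omega
  rw [bRep_eq]
  constructor
  · refine Submodule.sum_mem _ fun m hm => Submodule.smul_of_tower_mem _ _ ?_
    rw [ht m hm, hM m hm]
    have := (mayT p n k).F_mul (bar_xiElt_pow_mem hk hi (mem_Ioo.1 hm).2 j)
      (bar_xiElt_pow_mem hk hi (hF m hm) j)
    exact this
  · change cobarD (ZMod p) _ _ ∈ (mayT p n k).F 3 _ _
    rw [cobarD_transpotence (ZMod p) p hp.out]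
    refine Submodule.sum_mem _ fun m hm => Submodule.smul_of_tower_mem _ _ ?_
    rw [ht m hm, hM m hm, Nat.cast_one]
    refine Submodule.sub_mem _ ?_ ?_
    · rw [add_sub_assoc]
      have := (mayT p n k).F_mul (bar_xiElt_pow_mem hk hi (mem_Ioo.1 hm).2 j)
        (barPair_mem_mayT (comul_xiElt_pow_pow hk hi j (p - m)))
      exact this
    · rw [add_sub_right_comm]
      have := (mayT p n k).F_mul (barPair_mem_mayT (comul_xiElt_pow_pow hk hi j m))
        (bar_xiElt_pow_mem hk hi (hF m hm) j)
      exact this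

end TensorFiltration

/-! ### Comparison of the classes -/

section Comparison

variable (p n k : ℕ) [hp : Fact p.Prime]

theorem MoravaS.pow_pow_mod (x : MoravaS p n k) (j : ℕ) : x ^ p ^ (j % n) = x ^ p ^ j := by
  have h : ∀ c, x ^ p ^ (n * c) = x := by
    intro c
    induction c with
    | zero => simp
    | succ c ih => rw [mul_add, mul_one, pow_add, pow_mul, ih, MoravaS.pow_eq]
  conv_rhs => rw [← Nat.div_add_mod j n, pow_add, pow_mul, h]

variable [NeZero n] [NeZero k]

theorem cobarMap_hRep {i : ℕ} (hi : i < n + k) (j : ℕ) :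
    cobarMap (reductionMap p n k) (hRep p (xiElt p n k i) j) = hRep p (tElt p n k i) (j % n) := by
  rw [hRep, hRep, cobarMap_bar, map_pow, reductionMap_xiElt p n k hi, MoravaS.pow_pow_mod]

theorem cobarMap_bRep {i : ℕ} (hi : i < n + k) (j : ℕ) :
    cobarMap (reductionMap p n k) (bRep p (xiElt p n k i) j) = bRep p (tElt p n k i) (j % n) := by
  rw [bRep_eq, bRep_eq, map_sum]
  refine Finset.sum_congr rfl fun m _ => ?_
  simp only [map_nsmul, map_mul, cobarMap_bar, map_pow, reductionMap_xiElt p n k hi,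
    MoravaS.pow_pow_mod]

end Comparison

end MaySS

theorem theorem4p4 (p n k : ℕ) [Fact p.Prime] (hp : p ≠ 2) [NeZero n] [NeZero k] :
    (∀ i, k ≤ i → i < n + k → MaySS.reductionMap p n k (MaySS.xiElt p n k i) = MaySS.tElt p n k i) ∧
    (∀ t M : ℤ, ∀ x ∈ MaySS.filtT p n k t M,
      MaySS.reductionMap p n k x ∈ MaySS.filtS p n k t M) ∧
    (∀ s t M : ℤ, ∀ z ∈ (MaySS.mayT p n k).F s t M,
      MaySS.cobarMap (MaySS.reductionMap p n k) z ∈ (MaySS.mayS p n k).F s t M) ∧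
    (∀ z, MaySS.cobarMap (MaySS.reductionMap p n k) ((MaySS.mayT p n k).d z) =
      (MaySS.mayS p n k).d (MaySS.cobarMap (MaySS.reductionMap p n k) z)) ∧
    ∃ Φ : ∀ (r : ℕ) (s t M : ℤ),
        (MaySS.mayT p n k).E r s t M →ₗ[ZMod p] (MaySS.mayS p n k).E r s t M,
      (∀ (r : ℕ) (s t M : ℤ) (z : MaySS.Cobar (ZMod p) (MaySS.MoravaT p n k))
        (hz : z ∈ (MaySS.mayT p n k).Z r s t M),
        ∃ hz' : MaySS.cobarMap (MaySS.reductionMap p n k) z ∈ (MaySS.mayS p n k).Z r s t M,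
          Φ r s t M ((MaySS.mayT p n k).cls r s t M z hz) =
            (MaySS.mayS p n k).cls r s t M (MaySS.cobarMap (MaySS.reductionMap p n k) z) hz') ∧
      (∀ (r : ℕ) (s t M : ℤ) (x : (MaySS.mayT p n k).E r s t M),
        Φ r (s + 1) t (M - r) ((MaySS.mayT p n k).dE r s t M x) =
          (MaySS.mayS p n k).dE r s t M (Φ r s t M x)) ∧
      (∀ (r : ℕ) (s t M : ℤ) (x : (MaySS.mayT p n k).E r s t M)
        (y : (MaySS.mayT p n k).E (r + 1) s t M), (MaySS.mayT p n k).Survives x y →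
        (MaySS.mayS p n k).Survives (Φ r s t M x) (Φ (r + 1) s t M y)) ∧
      (∀ (r : ℕ) (s t M s' t' M' : ℤ) (x : (MaySS.mayT p n k).E r s t M)
        (y : (MaySS.mayT p n k).E r s' t' M'),
        Φ r (s + s') (t + t') (M + M') ((MaySS.mayT p n k).mulE r s t M s' t' M' x y) =
          (MaySS.mayS p n k).mulE r s t M s' t' M' (Φ r s t M x) (Φ r s' t' M' y)) ∧
      (∀ i j : ℕ, k ≤ i → i < n + k →
        ∃ (h : MaySS.hRep p (MaySS.xiElt p n k i) j ∈
              (MaySS.mayT p n k).Z (1 : ℕ) 1 (2 * (p ^ i - 1) * p ^ j) (2 * i - 1))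
          (h' : MaySS.hRep p (MaySS.tElt p n k i) (j % n) ∈
              (MaySS.mayS p n k).Z (1 : ℕ) 1 (2 * (p ^ i - 1) * p ^ j) (2 * i - 1)),
          Φ 1 _ _ _ ((MaySS.mayT p n k).cls 1 _ _ _ _ h) =
            (MaySS.mayS p n k).cls 1 _ _ _ _ h') ∧
      (∀ i j : ℕ, k ≤ i → i < n + k →
        ∃ (h : MaySS.bRep p (MaySS.xiElt p n k i) j ∈
              (MaySS.mayT p n k).Z (1 : ℕ) 2 (2 * (p ^ i - 1) * p ^ (j + 1)) (p * (2 * i - 1)))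
          (h' : MaySS.bRep p (MaySS.tElt p n k i) (j % n) ∈
              (MaySS.mayS p n k).Z (1 : ℕ) 2 (2 * (p ^ i - 1) * p ^ (j + 1)) (p * (2 * i - 1))),
          Φ 1 _ _ _ ((MaySS.mayT p n k).cls 1 _ _ _ _ h) =
            (MaySS.mayS p n k).cls 1 _ _ _ _ h') ∧
      (∀ (r : ℕ) (s t M : ℤ) (x : (MaySS.mayT p n k).E r s t M),
        (MaySS.mayT p n k).IsPermanentCycle x →
        (MaySS.mayS p n k).IsPermanentCycle (Φ r s t M x)) := by
  have hcls : ∀ {r : ℕ} {s t M : ℤ} {z : MaySS.Cobar (ZMod p) (MaySS.MoravaT p n k)}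
      {w : MaySS.Cobar (ZMod p) (MaySS.MoravaS p n k)}
      (hz : z ∈ (MaySS.mayT p n k).Z r s t M),
      MaySS.cobarMap (MaySS.reductionMap p n k) z = w →
      ∃ (h : z ∈ (MaySS.mayT p n k).Z r s t M) (h' : w ∈ (MaySS.mayS p n k).Z r s t M),
        (MaySS.mayHom p n k).mapE r s t M ((MaySS.mayT p n k).cls r s t M z h) =
          (MaySS.mayS p n k).cls r s t M w h' := by
    rintro r s t M z _ hz rfl
    exact ⟨hz, (MaySS.mayHom p n k).map_Z hz, rfl⟩
  exact ⟨fun i _ hi => MaySS.reductionMap_xiElt p n k hi,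
    fun _ _ _ hx => MaySS.reductionMap_mem_filtS p n k hx,
    fun _ _ _ _ hz => MaySS.cobarMap_reductionMap_mem p n k hz,
    MaySS.cobarMap_cobarD _,
    (MaySS.mayHom p n k).mapE,
    fun _ _ _ _ _ hz => ⟨(MaySS.mayHom p n k).map_Z hz, rfl⟩,
    (MaySS.mayHom p n k).mapE_dE,
    fun _ _ _ _ _ _ => (MaySS.mayHom p n k).mapE_survives,
    (MaySS.mayHom p n k).mapE_mulE,
    fun i j hk hi => hcls (MaySS.hRep_xiElt_mem_Z hk hi j) (MaySS.cobarMap_hRep p n k hi j),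
    fun i j hk hi => hcls (MaySS.bRep_xiElt_mem_Z hk hi j) (MaySS.cobarMap_bRep p n k hi j),
    fun _ _ _ _ _ => (MaySS.mayHom p n k).mapE_isPermanentCycle⟩
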